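/- Let $G$ be a finitely generated group and let $\Delta>0$. A geodesic triangle in a geodesic metric space is $\Delta$-thin if each side is contained in the $\Delta$-neighbourhood of the union of the other two sides. Let $\mathrm{Hom}_\Delta(G)$ be the collection of all homomorphisms $\rho:G\to\mathrm{Isom}(X)$, where $X$ ranges over all nonempty geodesic metric spaces in which every geodesic triangle is $\Delta$-thin. Let $\mathrm{LF}(G)=\mathbb R^G$ with the product topology, and for an isometric action $\rho$ of $G$ on a nonempty metric space $X$ let $L(\rho)\in \mathrm{LF}(G)$ be its length function $$L(\rho)(g)=\inf\{d_X(x,\rho(g)x) : x\in X\}.$$ Let $\mathrm{PLF}(G)=(\mathrm{LF}(G)\setminus 0)/(\mathbb R\setminus 0)$, and let $\overline{\mathrm{LF}(G)}=\mathrm{LF}(G)\cup\mathrm{PLF}(G)$ be topologized as the projective space $\big((\mathrm{LF}(G)\times\mathbb R)\setminus 0\big)/(\mathbb R\setminus 0)$ with the quotient topology, where $L\in\mathrm{LF}(G)$ corresponds to the class of $(L,1)$ and $[L]\in \mathrm{PLF}(G)$ to the class of $(L,0)$; thus a sequence $L_n\in\mathrm{LF}(G)$ converges to $[L]\in\mathrm{PLF}(G)$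 if and only if there are $\lambda_n\to0$ with $\lambda_nL_n\to L$ in $\mathrm{LF}(G)$. Then the image of $L:\mathrm{Hom}_\Delta(G)\to\mathrm{LF}(G)$ has compact closure in $\overline{\mathrm{LF}(G)}$. Moreover, every point of this closure that lies in $\mathrm{PLF}(G)$ is the class $[L(\sigma)]$ of the (not identically zero) length function of an action $\sigma$ of $G$ by isometries on an $\mathbb R$-tree with no global fixed point. -/

import Mathlib

open Filter Topology
open scoped LinearAlgebra.Projectivization

universe u v

noncomputable section

/-! ### Geodesic spaces with thin triangles -/

/-- `s` is (the image of) a geodesic with endpoints `a` and `b`, parametrised by arc length.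
For `a = b` this is the degenerate geodesic `{a}`. -/
def IsGeodesicSegment {X : Type*} [MetricSpace X] (s : Set X) (a b : X) : Prop :=
  ∃ γ : ℝ → X, γ 0 = a ∧ γ (dist a b) = b ∧
    (∀ t ∈ Set.Icc 0 (dist a b), ∀ u ∈ Set.Icc 0 (dist a b), dist (γ t) (γ u) = |t - u|) ∧
    γ '' Set.Icc 0 (dist a b) = s

/-- Any two points are joined by a geodesic. -/
def IsGeodesicSpace (X : Type*) [MetricSpace X] : Prop :=
  ∀ a b : X, ∃ s : Set X, IsGeodesicSegment s a b

/-- Every geodesic triangle is `Δ`-thin: each side is contained in the `Δ`-neighbourhood of the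
union of the other two.  (The triangle is arbitrary, so it is enough to name one side.) -/
def HasThinTriangles (Δ : ℝ) (X : Type*) [MetricSpace X] : Prop :=
  ∀ (a b c : X) (s₁ s₂ s₃ : Set X), IsGeodesicSegment s₁ a b → IsGeodesicSegment s₂ b c →
    IsGeodesicSegment s₃ c a → ∀ x ∈ s₁, ∃ y ∈ s₂ ∪ s₃, dist x y ≤ Δ

/-! ### `ℝ`-trees -/

/-- `s` is an arc (the image of an injective path) with endpoints `a` and `b`. -/
def IsArcBetween {X : Type*} [TopologicalSpace X] (s : Set X) (a b : X) : Prop :=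
  ∃ f : ℝ → X, ContinuousOn f (Set.Icc 0 1) ∧ Set.InjOn f (Set.Icc 0 1) ∧
    f 0 = a ∧ f 1 = b ∧ f '' Set.Icc 0 1 = s

/-- A (nonempty) `ℝ`-tree: any two distinct points are the endpoints of a unique arc, and this arc
is isometric to an interval.  (In particular the metric is a path metric.) -/
structure IsRTree (T : Type*) [MetricSpace T] : Prop where
  nonempty : Nonempty T
  existsUnique_arc : ∀ a b : T, a ≠ b → ∃! s : Set T, IsArcBetween s a b
  arc_isometric : ∀ (a b : T) (s : Set T), IsArcBetween s a b → IsGeodesicSegment s a b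

/-! ### Length functions -/

/-- The space `ℝ ^ G` of length functions on `G`, with the product topology. -/
abbrev LF (G : Type*) : Type _ := G → ℝ

/-- The set of projectivized length functions `(LF(G) - 0) / (ℝ - 0)`. -/
abbrev PLF (G : Type*) : Type _ := ℙ ℝ (LF G)

/-- The translation length `inf {d(x, τ x)}` of an isometry. -/
def translationLength {X : Type*} [MetricSpace X] (τ : X ≃ᵢ X) : ℝ :=
  ⨅ x : X, dist x (τ x)

/-- The length function of an isometric action. -/
def lengthFunction {G X : Type*} [Group G] [MetricSpace X] (ρ : G →* (X ≃ᵢ X)) : LF G :=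
  fun g => translationLength (ρ g)

/-- The collection of all homomorphisms of `G` into isometry groups of (nonempty) geodesic spaces
with `Δ`-thin triangles. -/
structure HomThin (Δ : ℝ) (G : Type u) [Group G] where
  X : Type v
  [metricSpace : MetricSpace X]
  [nonempty : Nonempty X]
  geodesic : IsGeodesicSpace X
  thin : HasThinTriangles Δ X
  ρ : G →* (X ≃ᵢ X)

attribute [instance] HomThin.metricSpace HomThin.nonempty

/-- The map `L` from homomorphisms to length functions. -/
def HomThin.L {Δ : ℝ} {G : Type u} [Group G] (r : HomThin.{u, v} Δ G) : LF G :=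
  lengthFunction r.ρ

/-! ### The space `LF(G) ∪ PLF(G)` -/

/-- The disjoint union of `LF(G)` and `PLF(G)`; the latter consists of the ideal points. -/
inductive LFBar (G : Type*) : Type _
  | finite (L : LF G) : LFBar G
  | ideal (p : PLF G) : LFBar G

/-- The map `(LF(G) × ℝ) - 0 → LF(G) ∪ PLF(G)` sending `(L, t)` to `t⁻¹ L` if `t ≠ 0` and `(L, 0)`
to `[L]`.  Its fibres are the orbits of `ℝ - 0`, so it identifies `LF(G) ∪ PLF(G)` with the
projective space of `LF(G) × ℝ`. -/
def LFBar.ofHomogeneous {G : Type*} (p : {p : LF G × ℝ // p ≠ 0}) : LFBar G :=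
  if h : p.1.2 = 0 then
    .ideal (Projectivization.mk ℝ p.1.1 (fun h' => p.2 (Prod.ext h' h)))
  else .finite (p.1.2⁻¹ • p.1.1)

/-- `LF(G) ∪ PLF(G)` carries the quotient topology. -/
instance LFBar.topologicalSpace (G : Type*) : TopologicalSpace (LFBar G) :=
  TopologicalSpace.coinduced LFBar.ofHomogeneous inferInstance

/-- The fibres of `ofHomogeneous` are the orbits of `ℝ - 0`. -/
theorem LFBar.ofHomogeneous_eq_iff {G : Type*} (p q : {p : LF G × ℝ // p ≠ 0}) :
    LFBar.ofHomogeneous p = LFBar.ofHomogeneous q ↔ ∃ c : ℝ, c ≠ 0 ∧ q.1 = c • p.1 := by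
  obtain ⟨⟨L, t⟩, hp⟩ := p
  obtain ⟨⟨M, u⟩, hq⟩ := q
  by_cases ht : t = 0 <;> by_cases hu : u = 0
  · subst ht hu
    simp only [LFBar.ofHomogeneous, dif_pos, LFBar.ideal.injEq, Projectivization.mk_eq_mk_iff']
    constructor
    · rintro ⟨a, ha⟩
      have ha0 : a ≠ 0 := by
        rintro rfl
        exact hp (by simp [← ha])
      exact ⟨a⁻¹, inv_ne_zero ha0, by simp [← ha, smul_smul, ha0]⟩
    · rintro ⟨c, hc, h⟩
      simp only [Prod.smul_mk, Prod.mk.injEq] at h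
      exact ⟨c⁻¹, by simp [h.1, smul_smul, hc]⟩
  · subst ht
    simp only [LFBar.ofHomogeneous, dif_pos, dif_neg hu, reduceCtorEq, false_iff]
    rintro ⟨c, -, h⟩
    simp only [Prod.smul_mk, Prod.mk.injEq, smul_zero] at h
    exact hu h.2
  · subst hu
    simp only [LFBar.ofHomogeneous, dif_pos, dif_neg ht, reduceCtorEq, false_iff]
    rintro ⟨c, hc, h⟩
    simp only [Prod.smul_mk, Prod.mk.injEq, smul_eq_mul] at h
    exact mul_ne_zero hc ht h.2.symm
  · simp only [LFBar.ofHomogeneous, dif_neg ht, dif_neg hu, LFBar.finite.injEq]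
    constructor
    · intro h
      refine ⟨u * t⁻¹, mul_ne_zero hu (inv_ne_zero ht), ?_⟩
      simp only [Prod.smul_mk, Prod.mk.injEq, smul_eq_mul, mul_smul]
      refine ⟨?_, by field_simp⟩
      rw [h, smul_smul, mul_inv_cancel₀ hu, one_smul]
    · rintro ⟨c, hc, h⟩
      simp only [Prod.smul_mk, Prod.mk.injEq, smul_eq_mul] at h
      rw [h.1, h.2, smul_smul]
      congr 1
      field_simp

/-- The quotient topology is such that a sequence `L n` in `LF(G)` converges to `[M]` in `PLF(G)`
if and only if there are `c n → 0` such that `c n • L n → M` in `LF(G)`. -/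
theorem LFBar.tendsto_ideal_iff {G : Type*} (L : ℕ → LF G) (M : LF G) (hM : M ≠ 0) :
    Tendsto (fun n => LFBar.finite (L n)) atTop (𝓝 (.ideal (Projectivization.mk ℝ M hM))) ↔
      ∃ c : ℕ → ℝ, Tendsto c atTop (𝓝 0) ∧ Tendsto (fun n => c n • L n) atTop (𝓝 M) := by
  have hM0 : ((M, 0) : LF G × ℝ) ≠ 0 := fun h => hM (congrArg Prod.fst h)
  have hideal : LFBar.ideal (Projectivization.mk ℝ M hM) =
      LFBar.ofHomogeneous ⟨(M, 0), hM0⟩ := by simp [LFBar.ofHomogeneous]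
  obtain ⟨g, hg⟩ : ∃ g, M g ≠ 0 := Function.ne_iff.1 hM
  constructor
  · intro h
    -- A set `W` of nonzero pairs that is open and invariant under scaling gives an open set.
    have key : ∀ W : Set (LF G × ℝ), IsOpen W → (M, 0) ∈ W → (∀ p ∈ W, ∀ c : ℝ, c ≠ 0 →
        c • p ∈ W) → ∀ᶠ n in atTop, (L n, (1 : ℝ)) ∈ W := by
      intro W hW hMW hinv
      have hop : IsOpen (LFBar.ofHomogeneous '' (Subtype.val ⁻¹' W) : Set (LFBar G)) := by
        rw [isOpen_coinduced]
        convert hW.preimage continuous_subtype_val using 1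
        ext p
        constructor
        · rintro ⟨q, hq, hqp⟩
          obtain ⟨c, hc, h'⟩ := (LFBar.ofHomogeneous_eq_iff q p).1 hqp
          show p.1 ∈ W
          rw [h']
          exact hinv _ hq c hc
        · intro hp
          exact ⟨p, hp, rfl⟩
      have := h.eventually (hop.mem_nhds (by rw [hideal]; exact ⟨_, hMW, rfl⟩))
      filter_upwards [this] with n hn
      obtain ⟨q, hq, hqn⟩ := hn
      have h1 : ((L n, 1) : LF G × ℝ) ≠ 0 := fun h => one_ne_zero (congrArg Prod.snd h)
      have h2 : LFBar.finite (L n) = LFBar.ofHomogeneous ⟨(L n, 1), h1⟩ := by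
        simp [LFBar.ofHomogeneous]
      rw [h2] at hqn
      obtain ⟨c, hc, h'⟩ := (LFBar.ofHomogeneous_eq_iff q _).1 hqn
      have := hinv _ hq c hc
      rwa [← h'] at this
    have key2 : ∀ φ : LF G × ℝ → ℝ, Continuous φ → (∀ p (c : ℝ), φ (c • p) = c * φ p) →
        Tendsto (fun n => φ (L n, 1) * (M g / L n g)) atTop (𝓝 (φ (M, 0))) := by
      intro φ hφ hlin
      rw [Metric.tendsto_nhds]
      intro ε hε
      have := key {p | p.1 g ≠ 0 ∧ |φ p * M g - φ (M, 0) * p.1 g| < ε * |p.1 g|} (by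
          have e1 : Continuous fun p : LF G × ℝ => p.1 g := by fun_prop
          exact (isOpen_ne_fun e1 continuous_const).inter (isOpen_lt
            (((hφ.mul continuous_const).sub (continuous_const.mul e1)).abs)
            (continuous_const.mul e1.abs)))
        ⟨hg, by simpa using mul_pos hε (abs_pos.2 hg)⟩ (by
          rintro p ⟨hp1, hp2⟩ c hc
          refine ⟨mul_ne_zero hc hp1, ?_⟩
          have e : φ (c • p) * M g - φ (M, 0) * (c • p).1 g =
              c * (φ p * M g - φ (M, 0) * p.1 g) := by
            rw [hlin]; simp only [Prod.smul_fst, Pi.smul_apply, smul_eq_mul]; ring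
          rw [e, abs_mul]
          simp only [Prod.smul_fst, Pi.smul_apply, smul_eq_mul, abs_mul]
          nlinarith [mul_lt_mul_of_pos_left hp2 (abs_pos.2 hc)])
      filter_upwards [this] with n hn
      obtain ⟨h1, h2⟩ := hn
      rw [Real.dist_eq]
      have e : φ (L n, 1) * (M g / L n g) - φ (M, 0) =
          (φ (L n, 1) * M g - φ (M, 0) * L n g) / L n g := by field_simp
      rw [e, abs_div, div_lt_iff₀ (abs_pos.2 h1)]
      exact h2
    refine ⟨fun n => M g / L n g, ?_, ?_⟩
    · simpa using key2 Prod.snd continuous_snd (fun p c => rfl)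
    · rw [tendsto_pi_nhds]
      intro k
      have := key2 (fun p => p.1 k) (by fun_prop) (fun p c => rfl)
      simpa [mul_comm] using this
  · rintro ⟨c, hc, hcL⟩
    have hlim : Tendsto (fun n => (c n • L n, c n)) atTop (𝓝 ((M, 0) : LF G × ℝ)) :=
      hcL.prodMk_nhds hc
    rw [hideal, tendsto_nhds]
    intro U hU hMU
    rw [isOpen_coinduced, isOpen_induced_iff] at hU
    obtain ⟨W, hW, hWU⟩ := hU
    have hMW : ((M, 0) : LF G × ℝ) ∈ W := by
      have : (⟨(M, 0), hM0⟩ : {p : LF G × ℝ // p ≠ 0}) ∈ Subtype.val ⁻¹' W := by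
        rw [hWU]; exact hMU
      exact this
    filter_upwards [hlim.eventually (hW.mem_nhds hMW), hlim.eventually_ne hM0] with n h1 h2
    have h3 : (⟨(c n • L n, c n), h2⟩ : {p : LF G × ℝ // p ≠ 0}) ∈ Subtype.val ⁻¹' W := h1
    rw [hWU] at h3
    have hcn : c n ≠ 0 := fun h0 => h2 (by simp [h0])
    have h4 : LFBar.ofHomogeneous ⟨(c n • L n, c n), h2⟩ = LFBar.finite (L n) := by
      simp [LFBar.ofHomogeneous, hcn, smul_smul]
    show LFBar.finite (L n) ∈ U
    rw [← h4]
    exact h3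

/-- `LF(G)` is embedded in `LF(G) ∪ PLF(G)` as an open subspace. -/
theorem LFBar.isOpenEmbedding_finite (G : Type*) :
    IsOpenEmbedding (LFBar.finite : LF G → LFBar G) := by
  have h1 : ∀ L : LF G, ((L, 1) : LF G × ℝ) ≠ 0 := fun L h => one_ne_zero (congrArg Prod.snd h)
  have h2 : (LFBar.finite : LF G → LFBar G) = LFBar.ofHomogeneous ∘ fun L => ⟨(L, 1), h1 L⟩ := by
    ext L
    simp [LFBar.ofHomogeneous]
  refine .of_continuous_injective_isOpenMap ?_ (fun _ _ h => by simpa using h) ?_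
  · rw [h2]
    exact continuous_coinduced_rng.comp (by fun_prop)
  · intro V hV
    rw [isOpen_coinduced, isOpen_iff_mem_nhds]
    rintro ⟨⟨L, t⟩, hp⟩ ⟨M, hM, hMp⟩
    have ht : t ≠ 0 := by
      rintro rfl
      simp [LFBar.ofHomogeneous] at hMp
    have hc : ContinuousAt (fun p : {p : LF G × ℝ // p ≠ 0} => p.1.2⁻¹ • p.1.1) ⟨(L, t), hp⟩ := by
      have e1 : Continuous fun p : {p : LF G × ℝ // p ≠ 0} => p.1.2 := by fun_prop
      have e2 : Continuous fun p : {p : LF G × ℝ // p ≠ 0} => p.1.1 := by fun_prop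
      exact (e1.continuousAt.inv₀ ht).smul e2.continuousAt
    have hc2 : ContinuousAt (fun p : {p : LF G × ℝ // p ≠ 0} => p.1.2) ⟨(L, t), hp⟩ := by fun_prop
    simp only [LFBar.ofHomogeneous, dif_neg ht, LFBar.finite.injEq] at hMp
    filter_upwards [hc.eventually (hV.mem_nhds (show t⁻¹ • L ∈ V from hMp ▸ hM)),
      hc2.eventually_ne ht] with p hp1 hp2
    exact ⟨_, hp1, by simp [LFBar.ofHomogeneous, hp2]⟩

end

/-!
Every `r` in `Hom_Δ(G)` is an action on a space that is Gromov hyperbolic with constant `3 * Δ`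
(`HasThinTriangles.fourPointHyperbolic`).  For such actions two facts hold, with error terms that
depend only on `Δ`.

* The translation length of an isometry is `max 0 (d(x, τ² x) - d(x, τ x))`, up to a bounded error,
  for every point `x` (`FourPointHyperbolic.abs_translationLength_sub_le`).
* If the elements of a finite generating set and their pairwise products have small translation
  length then some point is moved little by all the generators
  (`FourPointHyperbolic.exists_dist_le_of_translationLength_le`).

By the second fact there are a finite set `F ⊆ G`, constants `C g` and base points `x r` such that
`d(x r, g x r) ≤ C g * N r` for all `g`, where `N r` is the sum of the translation lengths of the
elements of `F` and of `3 * Δ`.  So the points `(L r, 1)` of the projective space have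
representatives `(N r)⁻¹ • (L r, 1)` in a compact set of nonzero vectors, `gaugeSlice`, and its
image in `LF(G) ∪ PLF(G)` is compact; it is closed because `LF(G) ∪ PLF(G)` is Hausdorff.

An ideal point of the closure is a limit of points `L r` along an ultrafilter.  Along it,
`(N r)⁻¹ • (L r, 1)` converges to a vector `(L, 0)` of the compact set, so `L ≠ 0` represents the
ideal point and `N r` tends to infinity.  The functions `(N r)⁻¹ * d(g x r, h x r)` on `G × G` are
bounded, and they converge to a left-invariant pseudometric on `G` that is `0`-hyperbolic.  It spans
an `ℝ`-tree, `SpannedTree`, to which the left translations of `G` extend.  The first fact, applied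
to the approximating actions and to the tree, shows that the length function of the tree is `L`
(`exists_rTree_of_tendsto_lengthFunction`).  As `L ≠ 0`, there is no global fixed point.
-/

/-! ### Gromov hyperbolicity -/

/-- The four-point form of Gromov hyperbolicity, at all base points: of the three ways to pair off
four points, the two with the larger sum of distances have sums that differ by at most `2 * δ`. -/
def FourPointHyperbolic (δ : ℝ) (X : Type*) [PseudoMetricSpace X] : Prop :=
  ∀ x y z w : X, dist x y + dist z w ≤
    max (dist x z + dist y w) (dist x w + dist y z) + 2 * δ

/-- The Gromov product `(x | y)` of two points with respect to the base point `o`. -/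
noncomputable def gromovProd {X : Type*} [PseudoMetricSpace X] (o x y : X) : ℝ :=
  (dist o x + dist o y - dist x y) / 2

section GromovProduct

variable {X : Type*} [PseudoMetricSpace X] {δ : ℝ}

theorem gromovProd_comm (o x y : X) : gromovProd o x y = gromovProd o y x := by
  simp only [gromovProd, dist_comm x y]
  ring

theorem gromovProd_self (o x : X) : gromovProd o x x = dist o x := by
  simp [gromovProd]

theorem gromovProd_nonneg (o x y : X) : 0 ≤ gromovProd o x y := by
  have := dist_triangle_left x y o
  unfold gromovProd
  linarith

theorem gromovProd_le_left (o x y : X) : gromovProd o x y ≤ dist o x := by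
  have := dist_triangle o x y
  unfold gromovProd
  linarith

theorem gromovProd_le_right (o x y : X) : gromovProd o x y ≤ dist o y := by
  rw [gromovProd_comm]
  exact gromovProd_le_left o y x

theorem FourPointHyperbolic.min_gromovProd_le (h : FourPointHyperbolic δ X) (o x y z : X) :
    min (gromovProd o x y) (gromovProd o y z) ≤ gromovProd o x z + δ := by
  have h1 := h x z y o
  rw [min_le_iff]
  unfold gromovProd
  have e1 := dist_comm x o
  have e2 := dist_comm y o
  have e3 := dist_comm z o
  have e4 := dist_comm z y
  rcases le_max_iff.1 (sub_le_iff_le_add.2 h1) with h2 | h2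
  · left; linarith
  · right; linarith

theorem FourPointHyperbolic.min_gromovProd_le₃ (h : FourPointHyperbolic δ X) (hδ : 0 ≤ δ)
    (o x y z w : X) :
    min (gromovProd o x y) (min (gromovProd o y z) (gromovProd o z w)) ≤
      gromovProd o x w + 2 * δ := by
  have h1 := h.min_gromovProd_le o x y w
  have h2 := h.min_gromovProd_le o y z w
  rcases min_le_iff.1 h1 with h3 | h3
  · exact (min_le_left _ _).trans (by linarith)
  · exact (min_le_right _ _).trans (h2.trans (by linarith))

/-- Points on the segments `[o, x]` and `[o, y]` are at the distance that they would have in the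
tripod spanned by `o`, `x`, `y`, up to an error controlled by the hyperbolicity constant. -/
theorem FourPointHyperbolic.abs_dist_sub_tripod_le (h : FourPointHyperbolic δ X) (hδ : 0 ≤ δ)
    {o x y p q : X} (hp : dist o p + dist p x = dist o x) (hq : dist o q + dist q y = dist o y) :
    |dist p q - (dist o p + dist o q -
      2 * min (min (dist o p) (dist o q)) (gromovProd o x y))| ≤ 4 * δ := by
  have e1 : gromovProd o p x = dist o p := by unfold gromovProd; linarith
  have e2 : gromovProd o q y = dist o q := by unfold gromovProd; linarith
  have h1 := h.min_gromovProd_le₃ hδ o p x y q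
  have h2 := h.min_gromovProd_le₃ hδ o x p q y
  rw [gromovProd_comm o y q, e1, e2] at h1
  rw [gromovProd_comm o x p, e1, e2] at h2
  have h3 := gromovProd_le_left o p q
  have h4 := gromovProd_le_right o p q
  rw [min_eq_right ((min_le_left _ _).trans h3), min_eq_left h4] at h2
  have h5 : min (min (dist o p) (dist o q)) (gromovProd o x y) ≤ gromovProd o p q + 2 * δ := by
    rwa [min_assoc, min_comm (dist o q)]
  have h6 : gromovProd o p q - 2 * δ ≤ min (min (dist o p) (dist o q)) (gromovProd o x y) :=
    le_min (le_min (by linarith) (by linarith)) (by linarith)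
  have e3 : dist p q = dist o p + dist o q - 2 * gromovProd o p q := by unfold gromovProd; ring
  rw [e3, abs_le]
  constructor <;> linarith

end GromovProduct

/-! ### Thin triangles and the four-point condition -/

theorem IsGeodesicSegment.isCompact {X : Type*} [MetricSpace X] {s : Set X} {a b : X}
    (h : IsGeodesicSegment s a b) : IsCompact s := by
  obtain ⟨γ, -, -, hγ, rfl⟩ := h
  refine isCompact_Icc.image_of_continuousOn ?_
  refine LipschitzOnWith.continuousOn (K := 1) (LipschitzOnWith.of_dist_le_mul ?_)
  intro t ht u hu
  rw [hγ t ht u hu, NNReal.coe_one, one_mul, Real.dist_eq]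

theorem IsGeodesicSegment.isPreconnected {X : Type*} [MetricSpace X] {s : Set X} {a b : X}
    (h : IsGeodesicSegment s a b) : IsPreconnected s := by
  obtain ⟨γ, -, -, hγ, rfl⟩ := h
  refine isPreconnected_Icc.image _ ?_
  refine LipschitzOnWith.continuousOn (K := 1) (LipschitzOnWith.of_dist_le_mul ?_)
  intro t ht u hu
  rw [hγ t ht u hu, NNReal.coe_one, one_mul, Real.dist_eq]

theorem IsGeodesicSegment.left_mem {X : Type*} [MetricSpace X] {s : Set X} {a b : X}
    (h : IsGeodesicSegment s a b) : a ∈ s := by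
  obtain ⟨γ, h0, -, -, rfl⟩ := h
  exact ⟨0, ⟨le_rfl, dist_nonneg⟩, h0⟩

theorem IsGeodesicSegment.right_mem {X : Type*} [MetricSpace X] {s : Set X} {a b : X}
    (h : IsGeodesicSegment s a b) : b ∈ s := by
  obtain ⟨γ, -, h1, -, rfl⟩ := h
  exact ⟨dist a b, ⟨dist_nonneg, le_rfl⟩, h1⟩

theorem IsGeodesicSegment.dist_add_dist {X : Type*} [MetricSpace X] {s : Set X} {a b p : X}
    (h : IsGeodesicSegment s a b) (hp : p ∈ s) : dist a p + dist p b = dist a b := by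
  obtain ⟨γ, h0, h1, hγ, rfl⟩ := h
  obtain ⟨t, ht, rfl⟩ := hp
  have e1 := hγ 0 ⟨le_rfl, dist_nonneg⟩ t ht
  have e2 := hγ t ht (dist a b) ⟨dist_nonneg, le_rfl⟩
  rw [h0] at e1
  rw [h1] at e2
  rw [e1, e2, abs_sub_comm, abs_of_nonneg (by linarith [ht.1]), abs_sub_comm,
    abs_of_nonneg (by linarith [ht.2])]
  ring

theorem IsGeodesicSegment.symm {X : Type*} [MetricSpace X] {s : Set X} {a b : X}
    (h : IsGeodesicSegment s a b) : IsGeodesicSegment s b a := by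
  obtain ⟨γ, h0, h1, hγ, rfl⟩ := h
  refine ⟨fun t => γ (dist a b - t), by simpa using h1, by simp [dist_comm b a, h0], ?_, ?_⟩
  · intro t ht u hu
    rw [dist_comm b a, Set.mem_Icc] at ht hu
    rw [hγ _ ⟨by linarith, by linarith⟩ _ ⟨by linarith, by linarith⟩, abs_sub_comm]
    congr 1
    ring
  · rw [dist_comm b a]
    ext x
    constructor
    · rintro ⟨t, ht, rfl⟩
      exact ⟨_, ⟨by linarith [ht.2], by linarith [ht.1]⟩, rfl⟩
    · rintro ⟨t, ht, rfl⟩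
      exact ⟨dist a b - t, ⟨by linarith [ht.2], by linarith [ht.1]⟩, by simp⟩

theorem IsGeodesicSpace.exists_dist_eq {X : Type*} [MetricSpace X] (hX : IsGeodesicSpace X)
    (a b : X) {t : ℝ} (ht : 0 ≤ t) (ht' : t ≤ dist a b) :
    ∃ p, dist a p = t ∧ dist p b = dist a b - t := by
  obtain ⟨s, γ, h0, h1, hγ, rfl⟩ := hX a b
  refine ⟨γ t, ?_, ?_⟩
  · have := hγ 0 ⟨le_rfl, dist_nonneg⟩ t ⟨ht, ht'⟩
    rwa [h0, zero_sub, abs_neg, abs_of_nonneg ht] at this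
  · have := hγ t ⟨ht, ht'⟩ (dist a b) ⟨dist_nonneg, le_rfl⟩
    rwa [h1, abs_sub_comm, abs_of_nonneg (by linarith)] at this

/-- By connectedness, each side of a thin triangle has a point that is close to both other
sides. -/
theorem HasThinTriangles.exists_near_both {X : Type*} [MetricSpace X] {Δ : ℝ}
    (hX : HasThinTriangles Δ X) {a b c : X} {s₁ s₂ s₃ : Set X} (h₁ : IsGeodesicSegment s₁ a b)
    (h₂ : IsGeodesicSegment s₂ b c) (h₃ : IsGeodesicSegment s₃ c a) :
    ∃ p ∈ s₁, (∃ q ∈ s₂, dist p q ≤ Δ) ∧ ∃ q ∈ s₃, dist p q ≤ Δ := by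
  have hΔ : 0 ≤ Δ := by
    obtain ⟨y, -, hy⟩ := hX a b c s₁ s₂ s₃ h₁ h₂ h₃ a h₁.left_mem
    exact dist_nonneg.trans hy
  have hcl : ∀ {s : Set X} {a b : X}, IsGeodesicSegment s a b →
      {x : X | ∃ y ∈ s, dist x y ≤ Δ} = {x | Metric.infDist x s ≤ Δ} := by
    intro s a b hs
    ext x
    constructor
    · rintro ⟨y, hy, hxy⟩
      exact (Metric.infDist_le_dist_of_mem hy).trans hxy
    · intro hx
      obtain ⟨y, hy, hxy⟩ := hs.isCompact.exists_infDist_eq_dist ⟨_, hs.left_mem⟩ x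
      exact ⟨y, hy, hxy ▸ hx⟩
  have hc : ∀ {s : Set X} {a b : X}, IsGeodesicSegment s a b →
      IsClosed {x : X | ∃ y ∈ s, dist x y ≤ Δ} := by
    intro s a b hs
    rw [hcl hs]
    exact isClosed_le (Metric.continuous_infDist_pt s) continuous_const
  obtain ⟨p, hp, hp2, hp3⟩ := isPreconnected_closed_iff.1 h₁.isPreconnected _ _ (hc h₂) (hc h₃)
    (by
      intro x hx
      obtain ⟨y, hy | hy, hxy⟩ := hX a b c s₁ s₂ s₃ h₁ h₂ h₃ x hx
      · exact Or.inl ⟨y, hy, hxy⟩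
      · exact Or.inr ⟨y, hy, hxy⟩)
    ⟨b, h₁.right_mem, b, h₂.left_mem, by simpa using hΔ⟩
    ⟨a, h₁.left_mem, a, h₃.right_mem, by simpa using hΔ⟩
  exact ⟨p, hp, hp2, hp3⟩

theorem gromovProd_le_dist_of_mem {X : Type*} [MetricSpace X] {s : Set X} {x y p : X}
    (h : IsGeodesicSegment s x y) (hp : p ∈ s) (o : X) : gromovProd o x y ≤ dist o p := by
  have h1 := h.dist_add_dist hp
  have h2 := dist_triangle o p x
  have h3 := dist_triangle o p y
  rw [dist_comm p x] at h2
  unfold gromovProd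
  linarith

/-- In a space with thin triangles the Gromov product `(x | y)` measures, up to a bounded error, the
distance from the base point to a segment `[x, y]`; the four-point condition follows since
`[x, z]` is close to `[x, y] ∪ [y, z]`. -/
theorem HasThinTriangles.fourPointHyperbolic {X : Type*} [MetricSpace X] {Δ : ℝ}
    (hX : HasThinTriangles Δ X) (hg : IsGeodesicSpace X) : FourPointHyperbolic (3 * Δ) X := by
  intro x z y o
  obtain ⟨sxz, hxz⟩ := hg x z
  obtain ⟨szo, hzo⟩ := hg z o
  obtain ⟨sox, hox⟩ := hg o x
  obtain ⟨szy, hzy⟩ := hg z y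
  obtain ⟨syx, hyx⟩ := hg y x
  obtain ⟨p, hp, ⟨q, hq, hpq⟩, q', hq', hpq'⟩ := hX.exists_near_both hxz hzo hox
  have h1 : dist o p - 2 * Δ ≤ gromovProd o x z := by
    have e1 := hzo.dist_add_dist hq
    have e2 := hox.dist_add_dist hq'
    have e3 := hxz.dist_add_dist hp
    have t1 := dist_triangle p q z
    have t2 := dist_triangle p q' x
    have t3 := dist_triangle p q o
    have t4 := dist_triangle p q' o
    have c1 := dist_comm z q
    have c2 := dist_comm x p
    have c3 := dist_comm o p
    have c4 := dist_comm o q'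
    have c5 := dist_comm o z
    unfold gromovProd
    linarith
  obtain ⟨w, hw, hpw⟩ := hX x z y _ _ _ hxz hzy hyx p hp
  have h2 : min (gromovProd o x y) (gromovProd o y z) ≤ dist o w := by
    rcases hw with hw | hw
    · refine (min_le_right _ _).trans ?_
      rw [gromovProd_comm]
      exact gromovProd_le_dist_of_mem hzy hw o
    · refine (min_le_left _ _).trans ?_
      rw [gromovProd_comm]
      exact gromovProd_le_dist_of_mem hyx hw o
  have h3 := dist_triangle_right o w p
  rw [dist_comm w p] at h3
  have h4 : min (gromovProd o x y) (gromovProd o y z) ≤ gromovProd o x z + 3 * Δ := by linarith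
  rw [← sub_le_iff_le_add, le_max_iff]
  unfold gromovProd at h4
  have e1 := dist_comm x o
  have e2 := dist_comm y o
  have e3 := dist_comm z o
  have e4 := dist_comm z y
  rcases min_le_iff.1 h4 with h5 | h5
  · left; linarith
  · right; linarith

/-! ### Translation lengths in hyperbolic spaces -/

section TranslationLength

variable {X : Type*} [MetricSpace X] {δ : ℝ}

theorem translationLength_le (τ : X ≃ᵢ X) (x : X) : translationLength τ ≤ dist x (τ x) :=
  ciInf_le ⟨0, by rintro _ ⟨y, rfl⟩; exact dist_nonneg⟩ x

theorem translationLength_nonneg (τ : X ≃ᵢ X) : 0 ≤ translationLength τ :=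
  Real.iInf_nonneg fun _ => dist_nonneg

/-- If `d(x, τ² x)` exceeds `d(x, τ x)` by more than the hyperbolicity error then the orbit of `x`
escapes linearly at the rate of this excess. -/
theorem FourPointHyperbolic.add_le_dist_iterate (h : FourPointHyperbolic δ X) (hδ : 0 ≤ δ)
    (τ : X ≃ᵢ X) (x : X) (hpos : 0 < dist x (τ (τ x)) - dist x (τ x) - 2 * δ) (n : ℕ) :
    dist x (τ^[n + 1] x) + (dist x (τ (τ x)) - dist x (τ x) - 2 * δ) ≤ dist x (τ^[n + 2] x) := by
  induction n with
  | zero =>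
    show dist x (τ x) + _ ≤ dist x (τ (τ x))
    linarith
  | succ n ih =>
    have h4 := h x (τ (τ x)) (τ x) (τ^[n + 3] x)
    have e1 : dist (τ x) (τ^[n + 3] x) = dist x (τ^[n + 2] x) := by
      rw [Function.iterate_succ_apply', τ.isometry.dist_eq]
    have e2 : dist (τ (τ x)) (τ^[n + 3] x) = dist x (τ^[n + 1] x) := by
      rw [Function.iterate_succ_apply', Function.iterate_succ_apply', τ.isometry.dist_eq,
        τ.isometry.dist_eq]
    have e3 : dist (τ (τ x)) (τ x) = dist x (τ x) := by
      rw [τ.isometry.dist_eq, dist_comm]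
    rw [e1, e2, e3] at h4
    show dist x (τ^[n + 2] x) + _ ≤ dist x (τ^[n + 3] x)
    rcases le_max_iff.1 (sub_le_iff_le_add.2 h4) with h6 | h6 <;> linarith

theorem FourPointHyperbolic.sub_le_translationLength [Nonempty X] (h : FourPointHyperbolic δ X)
    (hδ : 0 ≤ δ) (τ : X ≃ᵢ X) (x : X) :
    dist x (τ (τ x)) - dist x (τ x) - 2 * δ ≤ translationLength τ := by
  rcases le_or_gt (dist x (τ (τ x)) - dist x (τ x) - 2 * δ) 0 with h0 | h0
  · exact h0.trans (translationLength_nonneg τ)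
  set κ := dist x (τ (τ x)) - dist x (τ x) - 2 * δ with hκ
  refine le_ciInf fun y => ?_
  have hiter : ∀ (n : ℕ) (a b : X), dist (τ^[n] a) (τ^[n] b) = dist a b := by
    intro n a b
    induction n with
    | zero => rfl
    | succ n ih =>
      rw [Function.iterate_succ_apply', Function.iterate_succ_apply', τ.isometry.dist_eq, ih]
  have hlow : ∀ n : ℕ, n * κ ≤ dist x (τ^[n + 1] x) := by
    intro n
    induction n with
    | zero => simp
    | succ n ih =>
      have := h.add_le_dist_iterate hδ τ x h0 n
      push_cast
      linarith
  have hup : ∀ n : ℕ, dist y (τ^[n] y) ≤ n * dist y (τ y) := by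
    intro n
    induction n with
    | zero => simp
    | succ n ih =>
      have h1 := dist_triangle y (τ^[n] y) (τ^[n + 1] y)
      have h2 : dist (τ^[n] y) (τ^[n + 1] y) = dist y (τ y) := by
        rw [Function.iterate_succ_apply, hiter]
      push_cast
      linarith
  by_contra! hlt
  obtain ⟨n, hn⟩ := exists_nat_gt ((2 * dist x y + dist y (τ y)) / (κ - dist y (τ y)))
  rw [div_lt_iff₀ (by linarith)] at hn
  have h1 := hlow n
  have h2 := hup (n + 1)
  have h3 := dist_triangle4 x y (τ^[n + 1] y) (τ^[n + 1] x)
  rw [hiter, dist_comm y x] at h3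
  push_cast at h2
  linarith

/-- The midpoint of `[x, τ x]` is moved by little more than the translation length. -/
theorem FourPointHyperbolic.translationLength_le_max (h : FourPointHyperbolic δ X) (hδ : 0 ≤ δ)
    (hg : IsGeodesicSpace X) (τ : X ≃ᵢ X) (x : X) :
    translationLength τ ≤ max 0 (dist x (τ (τ x)) - dist x (τ x)) + 4 * δ := by
  have hd : 0 ≤ dist x (τ x) := dist_nonneg
  obtain ⟨p, hp, hp'⟩ := hg.exists_dist_eq x (τ x) (t := dist x (τ x) / 2) (by linarith)
    (by linarith)
  refine (translationLength_le τ p).trans ?_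
  have e1 : dist (τ x) p = dist x (τ x) / 2 := by rw [dist_comm]; linarith
  have e2 : dist (τ x) (τ p) = dist x (τ x) / 2 := by rw [τ.isometry.dist_eq, hp]
  have e3 : dist (τ p) (τ (τ x)) = dist x (τ x) / 2 := by rw [τ.isometry.dist_eq]; linarith
  have e4 : dist (τ x) (τ (τ x)) = dist x (τ x) := τ.isometry.dist_eq _ _
  have key := h.abs_dist_sub_tripod_le hδ (o := τ x) (x := x) (y := τ (τ x)) (p := p) (q := τ p)
    (by rw [e1, dist_comm p x, hp, dist_comm (τ x) x]; ring) (by rw [e2, e3, e4]; ring)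
  have e5 : gromovProd (τ x) x (τ (τ x)) = dist x (τ x) - dist x (τ (τ x)) / 2 := by
    unfold gromovProd
    rw [e4, dist_comm (τ x) x]
    ring
  rw [e1, e2, min_self, e5] at key
  have h1 := (abs_le.1 key).2
  rcases min_choice (dist x (τ x) / 2) (dist x (τ x) - dist x (τ (τ x)) / 2) with hm | hm
  · rw [hm] at h1
    have := le_max_left 0 (dist x (τ (τ x)) - dist x (τ x))
    linarith
  · rw [hm] at h1
    have := le_max_right 0 (dist x (τ (τ x)) - dist x (τ x))
    linarith

/-- In a hyperbolic geodesic space the translation length is determined, up to a bounded error, by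
the displacements of any one point under `τ` and `τ²`. -/
theorem FourPointHyperbolic.abs_translationLength_sub_le [Nonempty X]
    (h : FourPointHyperbolic δ X) (hδ : 0 ≤ δ) (hg : IsGeodesicSpace X) (τ : X ≃ᵢ X) (x : X) :
    |translationLength τ - max 0 (dist x (τ (τ x)) - dist x (τ x))| ≤ 4 * δ := by
  rw [abs_le]
  have h1 := h.translationLength_le_max hδ hg τ x
  have h2 := h.sub_le_translationLength hδ τ x
  have h3 := translationLength_nonneg τ
  refine ⟨?_, by linarith⟩
  rcases max_choice 0 (dist x (τ (τ x)) - dist x (τ x)) with hm | hm <;> rw [hm] <;> linarith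

end TranslationLength

/-! ### Joint displacement -/

section JointDisplacement

variable {X : Type*} [MetricSpace X] {δ : ℝ}

/-- If `s`, `t` and `s t` move `x` under their squares hardly further than under themselves, then
`s x` and `t x` lie in a common direction from `x`.  Otherwise the coarse fixed
sets of `s` and `t` would be far apart, and `s t` would translate along the bridge between them. -/
theorem FourPointHyperbolic.le_gromovProd_of_dist_sq_le (h : FourPointHyperbolic δ X)
    (hδ : 0 ≤ δ) (s t : X ≃ᵢ X) (x : X) {M : ℝ} (hM : 0 ≤ M)
    (hs : dist x (s (s x)) ≤ dist x (s x) + M) (ht : dist x (t (t x)) ≤ dist x (t x) + M)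
    (hst : dist x (s (t (s (t x)))) ≤ dist x (s (t x)) + M) :
    min (dist x (s x)) (dist x (t x)) / 2 - M / 2 - 2 * δ ≤ gromovProd x (s x) (t x) := by
  by_contra! hk
  set u := dist x (s x) with hu
  set v := dist x (t x) with hv
  set k := gromovProd x (s x) (t x) with hkdef
  have hmu : min u v ≤ u := min_le_left _ _
  have hmv : min u v ≤ v := min_le_right _ _
  have eA : dist x (s.symm x) = u := by
    rw [← s.isometry.dist_eq, s.apply_symm_apply, dist_comm]
  have eC : dist x (t.symm x) = v := by
    rw [← t.isometry.dist_eq, t.apply_symm_apply, dist_comm]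
  have eAB : dist (s.symm x) (s x) = dist x (s (s x)) := by
    rw [← s.isometry.dist_eq, s.apply_symm_apply]
  have eCE : dist (t.symm x) (t x) = dist x (t (t x)) := by
    rw [← t.isometry.dist_eq, t.apply_symm_apply]
  have eAE : dist (s.symm x) (t x) = dist x (s (t x)) := by
    rw [← s.isometry.dist_eq, s.apply_symm_apply]
  have hAB : (u - M) / 2 ≤ gromovProd x (s.symm x) (s x) := by
    unfold gromovProd
    rw [eA, eAB]
    linarith
  have hCE : (v - M) / 2 ≤ gromovProd x (t x) (t.symm x) := by
    unfold gromovProd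
    rw [eC, dist_comm (t x), eCE]
    linarith
  have hAE : gromovProd x (s.symm x) (t x) ≤ k + δ := by
    have h1 := h.min_gromovProd_le x (s x) (s.symm x) (t x)
    rw [gromovProd_comm x (s x) (s.symm x)] at h1
    rcases min_le_iff.1 h1 with h2 | h2 <;> linarith
  have hBC : gromovProd x (s x) (t.symm x) ≤ k + δ := by
    have h1 := h.min_gromovProd_le x (s x) (t.symm x) (t x)
    rw [gromovProd_comm x (t.symm x) (t x)] at h1
    rcases min_le_iff.1 h1 with h2 | h2 <;> linarith
  set w := dist x (s (t x)) with hw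
  have hwk : w = u + v - 2 * gromovProd x (s.symm x) (t x) := by
    unfold gromovProd
    rw [eA, eAE]
    ring
  have eQ : dist x (t.symm (s.symm x)) = w := by
    rw [← t.isometry.dist_eq, ← s.isometry.dist_eq, t.apply_symm_apply, s.apply_symm_apply,
      dist_comm]
  have eQC : dist (t.symm (s.symm x)) (t.symm x) = u := by
    rw [← t.isometry.dist_eq, t.apply_symm_apply, t.apply_symm_apply, dist_comm, eA]
  have eBP : dist (s x) (s (t x)) = v := s.isometry.dist_eq _ _
  have ePQ : dist (s (t x)) (t.symm (s.symm x)) = dist x (s (t (s (t x)))) := by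
    rw [dist_comm, ← t.isometry.dist_eq, ← s.isometry.dist_eq, t.apply_symm_apply,
      s.apply_symm_apply]
  have key := h.min_gromovProd_le₃ hδ x (s x) (s (t x)) (t.symm (s.symm x)) (t.symm x)
  have e1 : gromovProd x (s x) (s (t x)) = (u + w - v) / 2 := by
    unfold gromovProd
    rw [eBP]
  have e2 : (w - M) / 2 ≤ gromovProd x (s (t x)) (t.symm (s.symm x)) := by
    unfold gromovProd
    rw [eQ, ePQ]
    linarith
  have e3 : gromovProd x (t.symm (s.symm x)) (t.symm x) = (w + v - u) / 2 := by
    unfold gromovProd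
    rw [eQ, eQC, eC]
  rw [e1, e3] at key
  rcases min_le_iff.1 key with h2 | h2
  · linarith
  rcases min_le_iff.1 h2 with h2 | h2 <;> linarith

/-- Moving `x` towards `s x` decreases the displacement under every `t` for which the conclusion of
`le_gromovProd_of_dist_sq_le` places `t x` in the same direction. -/
theorem FourPointHyperbolic.dist_apply_le_of_gromovProd (h : FourPointHyperbolic δ X)
    (t : X ≃ᵢ X) {x y z : X} {M : ℝ} (hyz : dist x y + dist y z = dist x z)
    (hr : 2 * dist x y ≤ dist x (t x) - M) (hM : 0 ≤ M) (hδ : 0 ≤ δ)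
    (hz : dist x y ≤ gromovProd x z (t x))
    (ht : dist x (t (t x)) ≤ dist x (t x) + M) :
    dist y (t y) ≤ dist x (t x) - 2 * dist x y + 8 * δ := by
  set r := dist x y with hr_def
  have e1 : gromovProd x y z = r := by unfold gromovProd; linarith
  have h1 : r - δ ≤ gromovProd x y (t x) := by
    have := h.min_gromovProd_le x y z (t x)
    rw [e1, min_eq_left hz] at this
    linarith
  have eC : dist x (t.symm x) = dist x (t x) := by
    rw [← t.isometry.dist_eq, t.apply_symm_apply, dist_comm]
  have eCE : dist (t x) (t.symm x) = dist x (t (t x)) := by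
    rw [dist_comm, ← t.isometry.dist_eq, t.apply_symm_apply]
  have h2 : r - δ ≤ gromovProd x (t x) (t.symm x) := by
    unfold gromovProd
    rw [eC, eCE]
    linarith
  have h3 : r - 2 * δ ≤ gromovProd x y (t.symm x) := by
    have h4 := h.min_gromovProd_le x y (t x) (t.symm x)
    rcases min_le_iff.1 h4 with h5 | h5 <;> linarith
  unfold gromovProd at h1 h3
  have e2 : dist y (t.symm x) = dist (t y) x := by
    rw [← t.isometry.dist_eq, t.apply_symm_apply]
  rw [eC, e2] at h3
  have h4 := h y (t y) x (t x)
  rw [t.isometry.dist_eq y x, dist_comm y x] at h4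
  rcases le_max_iff.1 (sub_le_iff_le_add.2 h4) with h5 | h5 <;> linarith

/-- A coarse form of Serre's lemma on fixed points of groups generated by elliptic elements: if the
translation lengths of the elements of a finite set and of their products are small, then some
point is moved little by all elements of the set. -/
theorem FourPointHyperbolic.exists_dist_le_of_translationLength_le [Nonempty X]
    (h : FourPointHyperbolic δ X) (hδ : 0 < δ) (hg : IsGeodesicSpace X)
    {ι : Type*} (S : Finset ι) (ρ : ι → X ≃ᵢ X) {M : ℝ} (hM : 0 ≤ M)
    (h1 : ∀ i ∈ S, translationLength (ρ i) ≤ M)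
    (h2 : ∀ i ∈ S, ∀ j ∈ S, translationLength ((ρ j).trans (ρ i)) ≤ M) :
    ∃ x : X, ∀ i ∈ S, dist x (ρ i x) ≤ 4 * M + 48 * δ := by
  rcases S.eq_empty_or_nonempty with rfl | hS
  · exact ⟨Classical.arbitrary X, by simp⟩
  by_contra! hcon
  set f : X → ℝ := fun x => S.sup' hS fun i => dist x (ρ i x) with hf
  have hbig : ∀ x, 4 * M + 48 * δ < f x := by
    intro x
    obtain ⟨i, hi, hxi⟩ := hcon x
    exact hxi.trans_le (Finset.le_sup' (fun i => dist x (ρ i x)) hi)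
  have hbdd : BddBelow (Set.range f) := ⟨4 * M + 48 * δ, by
    rintro _ ⟨x, rfl⟩
    exact (hbig x).le⟩
  set D := ⨅ x, f x with hD
  have hD0 : 4 * M + 48 * δ ≤ D := le_ciInf fun x => (hbig x).le
  -- If `x` almost minimises the joint displacement `u` then the point `y` at distance `u / 8` from
  -- `x` towards `s x`, where `s` realises `u`, has displacement at most `19 / 20 * u`, below the
  -- infimum.
  obtain ⟨x, hx⟩ := exists_lt_of_ciInf_lt (show D < 20 / 19 * D by linarith)
  have hux := hbig x
  obtain ⟨s, hs, hsx⟩ := S.exists_mem_eq_sup' hS fun i => dist x (ρ i x)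
  set u := f x with hu
  change u = dist x (ρ s x) at hsx
  obtain ⟨y, hy, hy'⟩ := hg.exists_dist_eq x (ρ s x) (t := u / 8) (by linarith) (by linarith)
  have hsq : ∀ i ∈ S, dist x (ρ i (ρ i x)) ≤ dist x (ρ i x) + (M + 2 * δ) := by
    intro i hi
    have := h.sub_le_translationLength hδ.le (ρ i) x
    linarith [h1 i hi]
  have hDy : D ≤ f y := ciInf_le hbdd y
  have hfy : f y ≤ 19 / 20 * u := by
    refine Finset.sup'_le hS _ fun t ht => ?_
    have htu : dist x (ρ t x) ≤ u := Finset.le_sup' (fun i => dist x (ρ i x)) ht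
    rcases le_or_gt (u / 2) (dist x (ρ t x)) with hbt | hbt
    -- Elements with displacement at least `u / 2` at `x` gain `u / 4`, up to an error; the others
    -- lose at most `u / 4`.
    · have hk := h.le_gromovProd_of_dist_sq_le hδ.le (ρ s) (ρ t) x (M := M + 2 * δ)
        (by linarith) (hsq s hs) (hsq t ht) (by
          have := h.sub_le_translationLength hδ.le ((ρ t).trans (ρ s)) x
          simp only [IsometryEquiv.trans_apply] at this
          linarith [h2 s hs t ht])
      have hmin : u / 2 ≤ min (dist x (ρ s x)) (dist x (ρ t x)) := le_min (by linarith) hbt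
      have := h.dist_apply_le_of_gromovProd (ρ t) (x := x) (y := y) (z := ρ s x)
        (M := M + 2 * δ) (by linarith) (by linarith) (by linarith) hδ.le (by linarith) (hsq t ht)
      linarith
    · have h3 := dist_triangle4 y x (ρ t x) (ρ t y)
      rw [(ρ t).isometry.dist_eq, dist_comm y x] at h3
      linarith
  linarith

end JointDisplacement

/-! ### Geodesic spaces that are `0`-hyperbolic -/

section ZeroHyperbolic

variable {X : Type*} [PseudoMetricSpace X]

theorem FourPointHyperbolic.dist_eq_tripod (h : FourPointHyperbolic 0 X) {o x y p q : X}
    (hp : dist o p + dist p x = dist o x) (hq : dist o q + dist q y = dist o y) :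
    dist p q = dist o p + dist o q -
      2 * min (min (dist o p) (dist o q)) (gromovProd o x y) := by
  have := h.abs_dist_sub_tripod_le le_rfl hp hq
  rw [mul_zero] at this
  exact sub_eq_zero.1 (abs_nonpos_iff.1 this)

/-- In a `0`-hyperbolic space, points on a common segment are at the distance prescribed by their
parameters. -/
theorem FourPointHyperbolic.dist_eq_abs_sub (h : FourPointHyperbolic 0 X) {o x p q : X}
    (hp : dist o p + dist p x = dist o x) (hq : dist o q + dist q x = dist o x) :
    dist p q = |dist o p - dist o q| := by
  have h1 : dist o p ≤ dist o x := by linarith [dist_nonneg (x := p) (y := x)]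
  rw [h.dist_eq_tripod hp hq, gromovProd_self, min_eq_left ((min_le_left _ _).trans h1)]
  rcases le_total (dist o p) (dist o q) with h2 | h2
  · rw [min_eq_left h2, abs_of_nonpos (by linarith)]
    ring
  · rw [min_eq_right h2, abs_of_nonneg (by linarith)]
    ring

end ZeroHyperbolic

section RTree

variable {X : Type*} [MetricSpace X]

/-- In a `0`-hyperbolic space it suffices for geodesics to exist pointwise: the points found at the
various parameters automatically fit together. -/
theorem FourPointHyperbolic.isGeodesicSpace (h : FourPointHyperbolic 0 X)
    (hp : ∀ (a b : X) (t : ℝ), 0 ≤ t → t ≤ dist a b →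
      ∃ p, dist a p = t ∧ dist p b = dist a b - t) : IsGeodesicSpace X := by
  intro a b
  have : Nonempty X := ⟨a⟩
  choose! γ h1 h2 using hp a b
  refine ⟨_, γ, ?_, ?_, ?_, rfl⟩
  · exact (dist_eq_zero.1 (h1 0 le_rfl dist_nonneg)).symm
  · exact dist_eq_zero.1 ((h2 _ dist_nonneg le_rfl).trans (sub_self _))
  · intro t ht u hu
    have e1 := h1 t ht.1 ht.2
    have e2 := h1 u hu.1 hu.2
    have e3 := h2 t ht.1 ht.2
    have e4 := h2 u hu.1 hu.2
    rw [h.dist_eq_abs_sub (o := a) (x := b) (by linarith) (by linarith), e1, e2]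

/-- A point `z` strictly between `a` and `b` separates `a` from `b`: having a positive Gromov
product with `a` at `z` is an open condition on `X \ {z}`, and so is its negation. -/
theorem FourPointHyperbolic.mem_of_isPreconnected (h : FourPointHyperbolic 0 X) {s : Set X}
    (hs : IsPreconnected s) {a b z : X} (ha : a ∈ s) (hb : b ∈ s)
    (hz : dist a z + dist z b = dist a b) : z ∈ s := by
  by_contra hzs
  have haz : a ≠ z := fun e => hzs (e ▸ ha)
  have hbz : b ≠ z := fun e => hzs (e ▸ hb)
  have hcont : Continuous fun y => gromovProd z a y := by
    unfold gromovProd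
    fun_prop
  set U : Set X := {y | 0 < gromovProd z a y} with hU
  set V : Set X := {y | y ≠ z ∧ gromovProd z a y = 0} with hV
  have hUo : IsOpen U := isOpen_lt continuous_const hcont
  have hVo : IsOpen V := by
    rw [Metric.isOpen_iff]
    rintro y ⟨hyz, hy0⟩
    refine ⟨dist z y, dist_pos.2 (Ne.symm hyz), fun y' hy' => ?_⟩
    rw [Metric.mem_ball] at hy'
    have hy'z : y' ≠ z := by
      rintro rfl
      exact lt_irrefl _ hy'
    refine ⟨hy'z, le_antisymm ?_ (gromovProd_nonneg _ _ _)⟩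
    have h1 : 0 < gromovProd z y' y := by
      have := dist_pos.2 (Ne.symm hy'z)
      unfold gromovProd
      linarith
    have h2 := h.min_gromovProd_le z a y' y
    rw [hy0, add_zero] at h2
    rcases min_le_iff.1 h2 with h3 | h3
    · exact h3
    · exact absurd h3 (not_le.2 h1)
  have hsub : s ⊆ U ∪ V := by
    intro y hy
    rcases (gromovProd_nonneg z a y).lt_or_eq with h1 | h1
    · exact Or.inl h1
    · exact Or.inr ⟨fun e => hzs (e ▸ hy), h1.symm⟩
  have haU : a ∈ U := by
    show 0 < gromovProd z a a
    rw [gromovProd_self]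
    exact dist_pos.2 haz.symm
  have hbV : b ∈ V := ⟨hbz, by
    unfold gromovProd
    rw [dist_comm z a]
    linarith⟩
  obtain ⟨y, -, hyU, -, hyV⟩ := hs U V hUo hVo hsub ⟨a, ha, haU⟩ ⟨b, hb, hbV⟩
  exact hyU.ne' hyV

theorem IsArcBetween.isPreconnected {s : Set X} {a b : X} (hs : IsArcBetween s a b) :
    IsPreconnected s := by
  obtain ⟨f, hf, -, -, -, rfl⟩ := hs
  exact isPreconnected_Icc.image _ hf

/-- A connected subset of an arc that contains both endpoints is the whole arc. -/
theorem IsArcBetween.subset_of_isPreconnected {s k : Set X} {a b : X} (hs : IsArcBetween s a b)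
    (hk : IsPreconnected k) (hks : k ⊆ s) (ha : a ∈ k) (hb : b ∈ k) : s ⊆ k := by
  obtain ⟨f, hf, hinj, rfl, rfl, rfl⟩ := hs
  set F : Set.Icc (0 : ℝ) 1 → X := (Set.Icc (0 : ℝ) 1).domRestrict f with hF
  have hFc : Continuous F := hf.domRestrict
  have hFi : Function.Injective F := Set.injOn_iff_injective.1 hinj
  have hpre : IsPreconnected (F ⁻¹' k) := hk.preimage_of_isClosedMap hFi hFc.isClosedMap
    (by rw [hF, Set.range_domRestrict]; exact hks)
  have h01 := hpre.Icc_subset (show (0 : Set.Icc (0 : ℝ) 1) ∈ F ⁻¹' k from ha)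
    (show (1 : Set.Icc (0 : ℝ) 1) ∈ F ⁻¹' k from hb)
  rintro _ ⟨t, ht, rfl⟩
  exact h01 (show (⟨t, ht⟩ : Set.Icc (0 : ℝ) 1) ∈ Set.Icc 0 1 from
    ⟨Subtype.mk_le_mk.2 ht.1, Subtype.mk_le_mk.2 ht.2⟩)

/-- The arcs of a `0`-hyperbolic geodesic space are its geodesic segments: a geodesic is contained
in every arc with the same endpoints, and an arc has no proper connected subset containing its
endpoints. -/
theorem IsArcBetween.eq_of_isGeodesicSegment (h : FourPointHyperbolic 0 X) {s k : Set X} {a b : X}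
    (hs : IsArcBetween s a b) (hk : IsGeodesicSegment k a b) : s = k := by
  have hs' := hs
  obtain ⟨f, hf, -, hf0, hf1, hfs⟩ := hs'
  have ha : a ∈ s := hfs ▸ ⟨0, ⟨le_rfl, zero_le_one⟩, hf0⟩
  have hb : b ∈ s := hfs ▸ ⟨1, ⟨zero_le_one, le_rfl⟩, hf1⟩
  have hks : k ⊆ s := fun z hz =>
    h.mem_of_isPreconnected hs.isPreconnected ha hb (hk.dist_add_dist hz)
  exact (hs.subset_of_isPreconnected hk.isPreconnected hks hk.left_mem hk.right_mem).antisymm hks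

theorem IsGeodesicSegment.isArcBetween {s : Set X} {a b : X} (h : IsGeodesicSegment s a b)
    (hab : a ≠ b) : IsArcBetween s a b := by
  obtain ⟨γ, h0, h1, hγ, rfl⟩ := h
  have hd : 0 < dist a b := dist_pos.2 hab
  have hmem : ∀ t ∈ Set.Icc (0 : ℝ) 1, dist a b * t ∈ Set.Icc 0 (dist a b) := fun t ht =>
    ⟨mul_nonneg hd.le ht.1, mul_le_of_le_one_right hd.le ht.2⟩
  have hdist : ∀ t ∈ Set.Icc (0 : ℝ) 1, ∀ u ∈ Set.Icc (0 : ℝ) 1,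
      dist (γ (dist a b * t)) (γ (dist a b * u)) = dist a b * |t - u| := by
    intro t ht u hu
    rw [hγ _ (hmem t ht) _ (hmem u hu), ← mul_sub, abs_mul, abs_of_pos hd]
  refine ⟨fun t => γ (dist a b * t), ?_, ?_, by simpa using h0, by simpa using h1, ?_⟩
  · refine LipschitzOnWith.continuousOn (K := ⟨dist a b, hd.le⟩)
      (LipschitzOnWith.of_dist_le_mul fun t ht u hu => ?_)
    rw [hdist t ht u hu, Real.dist_eq]
    rfl
  · intro t ht u hu htu
    have := hdist t ht u hu
    rw [dist_eq_zero.2 htu, eq_comm, mul_eq_zero, or_iff_right hd.ne', abs_eq_zero] at this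
    exact sub_eq_zero.1 this
  · ext x
    constructor
    · rintro ⟨t, ht, rfl⟩
      exact ⟨_, hmem t ht, rfl⟩
    · rintro ⟨t, ht, rfl⟩
      refine ⟨t / dist a b, ⟨div_nonneg ht.1 hd.le, (div_le_one hd).2 ht.2⟩, ?_⟩
      show γ (dist a b * (t / dist a b)) = γ t
      rw [mul_div_cancel₀ _ hd.ne']

theorem FourPointHyperbolic.isRTree [Nonempty X] (h : FourPointHyperbolic 0 X)
    (hg : IsGeodesicSpace X) : IsRTree X where
  nonempty := inferInstance
  existsUnique_arc a b hab := by
    obtain ⟨k, hk⟩ := hg a b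
    exact ⟨k, hk.isArcBetween hab, fun s hs => hs.eq_of_isGeodesicSegment h hk⟩
  arc_isometric a b s hs := by
    obtain ⟨k, hk⟩ := hg a b
    rwa [hs.eq_of_isGeodesicSegment h hk]

end RTree

/-! ### The tree spanned by a `0`-hyperbolic space -/

/-- The inequality between real numbers by which an ultrametric inequality for Gromov products at
one base point gives the four-point condition at all base points. -/
theorem min_add_le_add_of_min_le {a b c d e f : ℝ} (h1 : min c f ≤ a) (h2 : min e d ≤ a)
    (h3 : min c e ≤ b) (h4 : min f d ≤ b) : min (c + d) (e + f) ≤ a + b := by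
  rw [min_le_iff] at *
  by_contra! hcon
  obtain ⟨hc1, hc2⟩ := hcon
  rcases h1 with h1 | h1 <;> rcases h2 with h2 | h2 <;> rcases h3 with h3 | h3 <;>
    rcases h4 with h4 | h4 <;> linarith

section SpannedTree

variable {S : Type u} [PseudoMetricSpace S]

/-- The points of the tree spanned by a `0`-hyperbolic space `S`, before points at distance zero are
identified: `(x, t)` stands for the point at distance `t` from `o` on the segment `[o, x]`. -/
structure Hull (_h : FourPointHyperbolic 0 S) (o : S) : Type u where
  /-- The endpoint of a segment from `o` that contains the point. -/
  tip : S
  /-- The distance from `o`. -/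
  height : ℝ
  height_nonneg : 0 ≤ height
  height_le : height ≤ dist o tip

namespace Hull

variable {h : FourPointHyperbolic 0 S} {o : S}

/-- The Gromov product of two points of the hull with respect to `o`: the length of the common
initial part of the segments from `o`. -/
noncomputable def prod (p q : Hull h o) : ℝ :=
  min (min p.height q.height) (gromovProd o p.tip q.tip)

theorem prod_comm (p q : Hull h o) : prod p q = prod q p := by
  unfold prod
  rw [gromovProd_comm, min_comm p.height]

theorem prod_self (p : Hull h o) : prod p p = p.height := by
  unfold prod
  rw [min_self, gromovProd_self, min_eq_left p.height_le]

theorem prod_le_left (p q : Hull h o) : prod p q ≤ p.height :=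
  (min_le_left _ _).trans (min_le_left _ _)

theorem prod_le_right (p q : Hull h o) : prod p q ≤ q.height :=
  (min_le_left _ _).trans (min_le_right _ _)

theorem min_prod_le (p q r : Hull h o) : min (prod p q) (prod q r) ≤ prod p r := by
  refine le_min (le_min ((min_le_left _ _).trans (prod_le_left _ _))
    ((min_le_right _ _).trans (prod_le_right _ _))) ?_
  have h1 := h.min_gromovProd_le o p.tip q.tip r.tip
  rw [add_zero] at h1
  exact (min_le_min (min_le_right _ _) (min_le_right _ _)).trans h1

noncomputable instance : PseudoMetricSpace (Hull h o) where
  dist p q := p.height + q.height - 2 * prod p q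
  dist_self p := by rw [prod_self]; ring
  dist_comm p q := by rw [prod_comm]; ring
  dist_triangle p q r := by
    have h1 := min_prod_le p q r
    have h2 := prod_le_right p q
    have h3 := prod_le_left q r
    rcases min_le_iff.1 h1 with h4 | h4 <;> linarith

theorem dist_def (p q : Hull h o) : dist p q = p.height + q.height - 2 * prod p q := rfl

theorem fourPointHyperbolic : FourPointHyperbolic 0 (Hull h o) := by
  intro x y z w
  have key := min_add_le_add_of_min_le (a := prod x y) (b := prod z w) (c := prod x z)
    (d := prod y w) (e := prod x w) (f := prod y z)
    (by have := min_prod_le x z y; rwa [prod_comm z y] at this)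
    (by have := min_prod_le x w y; rwa [prod_comm w y] at this)
    (by have := min_prod_le z x w; rwa [prod_comm z x] at this)
    (by have := min_prod_le z y w; rwa [prod_comm z y] at this)
  simp only [dist_def, mul_zero, add_zero]
  rw [le_max_iff]
  rcases min_le_iff.1 key with h1 | h1
  · left; linarith
  · right; linarith

/-- The inclusion of `S` into its hull. -/
noncomputable def of (h : FourPointHyperbolic 0 S) (o x : S) : Hull h o :=
  ⟨x, dist o x, dist_nonneg, le_rfl⟩

theorem dist_of_of (x y : S) : dist (of h o x) (of h o y) = dist x y := by
  have h1 := gromovProd_le_left o x y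
  have h2 := gromovProd_le_right o x y
  rw [dist_def]
  show dist o x + dist o y - 2 * min (min (dist o x) (dist o y)) (gromovProd o x y) = _
  rw [min_eq_right (le_min h1 h2)]
  unfold gromovProd
  ring

theorem dist_of_base (p : Hull h o) : dist (of h o o) p = p.height := by
  rw [dist_def]
  show dist o o + p.height - 2 * min (min (dist o o) p.height) (gromovProd o o p.tip) = _
  have : gromovProd o o p.tip = 0 := by simp [gromovProd]
  rw [this, dist_self, min_eq_left p.height_nonneg, min_self]
  ring

theorem dist_of_right (p : Hull h o) : dist p (of h o p.tip) = dist o p.tip - p.height := by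
  rw [dist_def]
  show p.height + dist o p.tip -
    2 * min (min p.height (dist o p.tip)) (gromovProd o p.tip p.tip) = _
  rw [gromovProd_self, min_eq_left p.height_le, min_eq_left p.height_le]
  ring

/-- The geodesic from `(x, t)` to `(y, s)` descends towards `o` up to the branching point of
`[o, x]` and `[o, y]`, and then ascends towards `y`. -/
theorem exists_dist_eq (p q : Hull h o) (t : ℝ) (ht : 0 ≤ t) (ht' : t ≤ dist p q) :
    ∃ r, dist p r = t ∧ dist r q = dist p q - t := by
  obtain ⟨x, a, ha0, ha⟩ := p
  obtain ⟨y, b, hb0, hb⟩ := q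
  have hg := gromovProd_nonneg o x y
  have e1 := gromovProd_self o x
  have e2 := gromovProd_self o y
  simp only [dist_def, prod] at ht' ⊢
  set m := min (min a b) (gromovProd o x y) with hm
  have hma : m ≤ a := (min_le_left _ _).trans (min_le_left _ _)
  have hmb : m ≤ b := (min_le_left _ _).trans (min_le_right _ _)
  have hmg : m ≤ gromovProd o x y := min_le_right _ _
  have hm0 : 0 ≤ m := le_min (le_min ha0 hb0) hg
  rcases le_or_gt t (a - m) with h1 | h1
  · refine ⟨⟨x, a - t, by linarith, by linarith⟩, ?_, ?_⟩
    · dsimp only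
      rw [e1, min_eq_right (show a - t ≤ a by linarith),
        min_eq_left (show a - t ≤ dist o x by linarith)]
      ring
    · dsimp only
      have : min (min (a - t) b) (gromovProd o x y) = m :=
        le_antisymm (min_le_min_right _ (min_le_min_right _ (by linarith)))
          (le_min (le_min (by linarith) hmb) hmg)
      rw [this]
      ring
  · refine ⟨⟨y, 2 * m + t - a, by linarith, by linarith⟩, ?_, ?_⟩
    · dsimp only
      have : min (min a (2 * m + t - a)) (gromovProd o x y) = m :=
        le_antisymm (min_le_min_right _ (min_le_min_left _ (by linarith)))
          (le_min (le_min hma (by linarith)) hmg)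
      rw [this]
      ring
    · dsimp only
      rw [e2, min_eq_left (show 2 * m + t - a ≤ b by linarith),
        min_eq_left (show 2 * m + t - a ≤ dist o y by linarith)]
      ring

end Hull

/-- The tree spanned by a `0`-hyperbolic space `S`: the union of all segments joining a base point
to the points of `S`. -/
abbrev SpannedTree (h : FourPointHyperbolic 0 S) (o : S) : Type u :=
  SeparationQuotient (Hull h o)

namespace SpannedTree

variable {h : FourPointHyperbolic 0 S} {o : S}

theorem fourPointHyperbolic : FourPointHyperbolic 0 (SpannedTree h o) := by
  intro x y z w
  obtain ⟨x, rfl⟩ := SeparationQuotient.surjective_mk x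
  obtain ⟨y, rfl⟩ := SeparationQuotient.surjective_mk y
  obtain ⟨z, rfl⟩ := SeparationQuotient.surjective_mk z
  obtain ⟨w, rfl⟩ := SeparationQuotient.surjective_mk w
  simp only [SeparationQuotient.dist_mk]
  exact Hull.fourPointHyperbolic x y z w

theorem isGeodesicSpace : IsGeodesicSpace (SpannedTree h o) := by
  refine fourPointHyperbolic.isGeodesicSpace fun a b t ht ht' => ?_
  obtain ⟨a, rfl⟩ := SeparationQuotient.surjective_mk a
  obtain ⟨b, rfl⟩ := SeparationQuotient.surjective_mk b
  rw [SeparationQuotient.dist_mk] at ht'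
  obtain ⟨r, h1, h2⟩ := Hull.exists_dist_eq a b t ht ht'
  exact ⟨SeparationQuotient.mk r, by rwa [SeparationQuotient.dist_mk],
    by rwa [SeparationQuotient.dist_mk, SeparationQuotient.dist_mk]⟩

/-- The map from `S` to the tree that it spans. -/
noncomputable def of (h : FourPointHyperbolic 0 S) (o x : S) : SpannedTree h o :=
  SeparationQuotient.mk (Hull.of h o x)

theorem dist_of_of (x y : S) : dist (of h o x) (of h o y) = dist x y := by
  unfold of
  rw [SeparationQuotient.dist_mk, Hull.dist_of_of]

theorem exists_dist_of (p : SpannedTree h o) :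
    ∃ x, dist (of h o o) p + dist p (of h o x) = dist (of h o o) (of h o x) := by
  obtain ⟨p, rfl⟩ := SeparationQuotient.surjective_mk p
  refine ⟨p.tip, ?_⟩
  unfold of
  rw [SeparationQuotient.dist_mk, SeparationQuotient.dist_mk, SeparationQuotient.dist_mk,
    Hull.dist_of_base, Hull.dist_of_right, Hull.dist_of_of]
  ring

/-- Distance-preserving maps from the spanned tree to a `0`-hyperbolic space are determined by
their restrictions to `S`. -/
theorem isometry_ext {Y : Type*} [MetricSpace Y] (hY : FourPointHyperbolic 0 Y)
    {f g : SpannedTree h o → Y} (hf : Isometry f) (hg : Isometry g)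
    (hfg : ∀ x, f (of h o x) = g (of h o x)) : f = g := by
  funext p
  obtain ⟨x, hx⟩ := exists_dist_of p
  have h1 := hf.dist_eq (of h o o) p
  have h2 := hf.dist_eq p (of h o x)
  have h3 := hg.dist_eq (of h o o) p
  have h4 := hg.dist_eq p (of h o x)
  have h5 := hf.dist_eq (of h o o) (of h o x)
  rw [← hfg] at h3 h4
  rw [← dist_eq_zero, hY.dist_eq_abs_sub (o := f (of h o o)) (x := f (of h o x))
    (by linarith) (by linarith), h1, h3, sub_self, abs_zero]

/-- A distance-preserving map from `S` to a `0`-hyperbolic geodesic space extends to the spanned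
tree. -/
theorem exists_extension {Y : Type*} [MetricSpace Y] (hY : FourPointHyperbolic 0 Y)
    (hgY : IsGeodesicSpace Y) (φ : S → Y) (hφ : Isometry φ) :
    ∃ f : SpannedTree h o → Y, Isometry f ∧ ∀ x, f (of h o x) = φ x := by
  have hex : ∀ p : Hull h o, ∃ r, dist (φ o) r = p.height ∧
      dist r (φ p.tip) = dist (φ o) (φ p.tip) - p.height := fun p =>
    hgY.exists_dist_eq _ _ p.height_nonneg (by rw [hφ.dist_eq]; exact p.height_le)
  choose F hF1 hF2 using hex
  have hgr : ∀ x y, gromovProd (φ o) (φ x) (φ y) = gromovProd o x y := by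
    intro x y
    simp only [gromovProd, hφ.dist_eq]
  have hF : ∀ p q, dist (F p) (F q) = dist p q := by
    intro p q
    rw [hY.dist_eq_tripod (o := φ o) (x := φ p.tip) (y := φ q.tip) (by rw [hF1, hF2]; ring)
      (by rw [hF1, hF2]; ring), hF1, hF1, hgr]
    rfl
  refine ⟨SeparationQuotient.lift F fun p q hpq => ?_, ?_, ?_⟩
  · rw [← dist_eq_zero, hF, ← Metric.inseparable_iff]
    exact hpq
  · refine Isometry.of_dist_eq fun p q => ?_
    obtain ⟨p, rfl⟩ := SeparationQuotient.surjective_mk p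
    obtain ⟨q, rfl⟩ := SeparationQuotient.surjective_mk q
    rw [SeparationQuotient.lift_mk, SeparationQuotient.lift_mk, SeparationQuotient.dist_mk, hF]
  · intro x
    show F (Hull.of h o x) = φ x
    rw [← dist_eq_zero]
    refine (hF2 (Hull.of h o x)).trans ?_
    show dist (φ o) (φ x) - dist o x = 0
    rw [hφ.dist_eq, sub_self]

end SpannedTree

/-- An isometric action on a `0`-hyperbolic space extends to the spanned tree. -/
theorem FourPointHyperbolic.exists_action_on_rTree {G : Type*} [Group G]
    (h : FourPointHyperbolic 0 S) (o : S) (ρ : G →* (S ≃ᵢ S)) :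
    ∃ σ : G →* (SpannedTree h o ≃ᵢ SpannedTree h o), ∀ g x,
      σ g (SpannedTree.of h o x) = SpannedTree.of h o (ρ g x) := by
  have hof : Isometry (SpannedTree.of h o) := Isometry.of_dist_eq SpannedTree.dist_of_of
  have hT : FourPointHyperbolic 0 (SpannedTree h o) := SpannedTree.fourPointHyperbolic
  choose Φ hΦ hΦof using fun g : G => SpannedTree.exists_extension (h := h) (o := o) hT
    SpannedTree.isGeodesicSpace (fun x => SpannedTree.of h o (ρ g x))
    (hof.comp (ρ g).isometry)
  have hone : Φ 1 = id := SpannedTree.isometry_ext hT (hΦ 1) isometry_id fun x => by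
    rw [hΦof, map_one]
    rfl
  have hmul : ∀ a b, Φ (a * b) = Φ a ∘ Φ b := fun a b =>
    SpannedTree.isometry_ext hT (hΦ _) ((hΦ a).comp (hΦ b)) fun x => by
      rw [Function.comp_apply, hΦof, hΦof, hΦof, map_mul]
      rfl
  refine ⟨MonoidHom.mk' (fun g => ⟨⟨Φ g, Φ g⁻¹, fun p => ?_, fun p => ?_⟩, hΦ g⟩) fun a b => ?_,
    fun g x => hΦof g x⟩
  · rw [← Function.comp_apply (f := Φ g⁻¹), ← hmul, inv_mul_cancel, hone, id]
  · rw [← Function.comp_apply (f := Φ g), ← hmul, mul_inv_cancel, hone, id]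
  · ext p
    exact congrFun (hmul a b) p

end SpannedTree

theorem FourPointHyperbolic.lengthFunction_eq {G X : Type*} [Group G] [MetricSpace X] [Nonempty X]
    (h : FourPointHyperbolic 0 X) (hg : IsGeodesicSpace X) (σ : G →* (X ≃ᵢ X)) (x : X) (g : G) :
    lengthFunction σ g = max 0 (dist x (σ (g * g) x) - dist x (σ g x)) := by
  have h1 := h.abs_translationLength_sub_le le_rfl hg (σ g) x
  rw [mul_zero] at h1
  rw [map_mul]
  exact sub_eq_zero.1 (abs_nonpos_iff.1 h1)

/-- A left-invariant `0`-hyperbolic pseudometric on a group comes from an action on an `ℝ`-tree,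
whose length function it determines. -/
theorem exists_rTree_of_leftInvariant {G : Type u} [Group G] (d : G → G → ℝ)
    (hself : ∀ g, d g g = 0) (hcomm : ∀ g h, d g h = d h g)
    (htri : ∀ a b c, d a c ≤ d a b + d b c)
    (hyp : ∀ a b c e, d a b + d c e ≤ max (d a c + d b e) (d a e + d b c))
    (hinv : ∀ k g h, d (k * g) (k * h) = d g h) :
    ∃ (T : Type u) (_ : MetricSpace T) (_ : IsRTree T) (σ : G →* (T ≃ᵢ T)),
      ∀ g, lengthFunction σ g = max 0 (d 1 (g * g) - d 1 g) := by
  let _ : PseudoMetricSpace G :=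
    { dist := d, dist_self := hself, dist_comm := hcomm, dist_triangle := htri }
  have hG : FourPointHyperbolic 0 G := fun a b c e => by
    rw [mul_zero, add_zero]
    exact hyp a b c e
  let ρ : G →* (G ≃ᵢ G) := MonoidHom.mk'
    (fun k => ⟨Equiv.mulLeft k, Isometry.of_dist_eq fun g h => hinv k g h⟩) fun a b => by
      ext g
      exact mul_assoc a b g
  obtain ⟨σ, hσ⟩ := hG.exists_action_on_rTree 1 ρ
  have hT : FourPointHyperbolic 0 (SpannedTree hG 1) := SpannedTree.fourPointHyperbolic
  have hgT : IsGeodesicSpace (SpannedTree hG 1) := SpannedTree.isGeodesicSpace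
  have hne : Nonempty (SpannedTree hG 1) := ⟨SpannedTree.of hG 1 1⟩
  refine ⟨SpannedTree hG 1, inferInstance, hT.isRTree hgT, σ, fun g => ?_⟩
  have hd : ∀ k : G, dist (SpannedTree.of hG 1 1) (σ k (SpannedTree.of hG 1 1)) = d 1 k := by
    intro k
    rw [hσ, SpannedTree.dist_of_of]
    show d 1 (k * 1) = _
    rw [mul_one]
  rw [hT.lengthFunction_eq hgT σ (SpannedTree.of hG 1 1), hd, hd]

/-! ### Rescaled limits of hyperbolic actions -/

/-- If the actions in a family are rescaled by factors that tend to infinity and the base points are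
displaced boundedly, then a limit of the rescaled length functions is the length function of an
action on an `ℝ`-tree.  Only the distances between points of the orbits of the base points pass to
the limit; they form a `0`-hyperbolic pseudometric on `G`. -/
theorem exists_rTree_of_tendsto_lengthFunction {G : Type u} [Group G] {ι : Type*}
    (𝓤 : Ultrafilter ι) {δ : ℝ} (hδ : 0 ≤ δ) (X : ι → Type v) [∀ i, MetricSpace (X i)]
    [∀ i, Nonempty (X i)] (hgeo : ∀ i, IsGeodesicSpace (X i))
    (hhyp : ∀ i, FourPointHyperbolic δ (X i)) (ρ : ∀ i, G →* (X i ≃ᵢ X i)) (x : ∀ i, X i)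
    (N : ι → ℝ) (hN : ∀ i, 0 < N i) (hN' : Tendsto (fun i => (N i)⁻¹) 𝓤 (𝓝 0)) (C : G → ℝ)
    (hC : ∀ i g, dist (x i) (ρ i g (x i)) ≤ C g * N i) (L : LF G)
    (hL : Tendsto (fun i => (N i)⁻¹ • lengthFunction (ρ i)) 𝓤 (𝓝 L)) :
    ∃ (T : Type u) (_ : MetricSpace T) (_ : IsRTree T) (σ : G →* (T ≃ᵢ T)),
      lengthFunction σ = L := by
  set D : ι → G → G → ℝ := fun i g h => (N i)⁻¹ * dist (ρ i g (x i)) (ρ i h (x i)) with hD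
  have hDinv : ∀ i k g h, D i (k * g) (k * h) = D i g h := by
    intro i k g h
    simp only [hD, map_mul, IsometryEquiv.mul_apply, (ρ i k).isometry.dist_eq]
  have hDmem : ∀ g h i, D i g h ∈ Set.Icc 0 (C (g⁻¹ * h)) := by
    intro g h i
    have h0 := hN i
    refine ⟨mul_nonneg (inv_nonneg.2 h0.le) dist_nonneg, ?_⟩
    rw [← hDinv i g⁻¹ g h, inv_mul_cancel]
    simp only [hD, map_one, IsometryEquiv.coe_one, id]
    rw [inv_mul_le_iff₀ h0, mul_comm]
    exact hC i _
  have hlim : ∀ g h, ∃ c, Tendsto (fun i => D i g h) 𝓤 (𝓝 c) := by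
    intro g h
    obtain ⟨c, -, hc⟩ := (isCompact_Icc (a := (0 : ℝ)) (b := C (g⁻¹ * h))).ultrafilter_le_nhds
      (𝓤.map fun i => D i g h)
      (tendsto_principal.2 (Eventually.of_forall (hDmem g h)))
    exact ⟨c, hc⟩
  choose d hd using hlim
  have hcs : Tendsto (fun i => (N i)⁻¹ * (2 * δ)) 𝓤 (𝓝 0) := by
    simpa using hN'.mul_const (2 * δ)
  obtain ⟨T, hT, hT', σ, hσ⟩ := exists_rTree_of_leftInvariant d
    (fun g => tendsto_nhds_unique (hd g g) (by simp [hD]))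
    (fun g h => tendsto_nhds_unique (hd g h) (by simpa [hD, dist_comm] using hd h g))
    (fun a b c => le_of_tendsto_of_tendsto' (hd a c) ((hd a b).add (hd b c)) fun i => by
      simp only [hD, ← mul_add]
      exact mul_le_mul_of_nonneg_left (dist_triangle _ _ _) (inv_nonneg.2 (hN i).le))
    (fun a b c e => by
      have h1 := ((hd a c).add (hd b e)).max ((hd a e).add (hd b c)) |>.add hcs
      rw [add_zero] at h1
      refine le_of_tendsto_of_tendsto' ((hd a b).add (hd c e)) h1 fun i => ?_
      have h0 := inv_nonneg.2 (hN i).le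
      simp only [hD, ← mul_add]
      rw [← mul_max_of_nonneg _ _ h0, ← mul_add]
      exact mul_le_mul_of_nonneg_left (hhyp i _ _ _ _) h0)
    (fun k g h => tendsto_nhds_unique (hd _ _) (by simpa only [hDinv] using hd g h))
  refine ⟨T, hT, hT', σ, ?_⟩
  funext g
  rw [hσ]
  have hLg := (tendsto_pi_nhds.1 hL) g
  have hmax : Tendsto (fun i => max 0 (D i 1 (g * g) - D i 1 g)) 𝓤
      (𝓝 (max 0 (d 1 (g * g) - d 1 g))) := tendsto_const_nhds.max ((hd _ _).sub (hd _ _))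
  have hdiff : Tendsto (fun i => ((N i)⁻¹ • lengthFunction (ρ i)) g -
      max 0 (D i 1 (g * g) - D i 1 g)) 𝓤 (𝓝 0) := by
    refine squeeze_zero_norm (a := fun i => (N i)⁻¹ * (4 * δ)) (fun i => ?_)
      (by simpa using hN'.mul_const (4 * δ))
    have h0 := inv_nonneg.2 (hN i).le
    have h1 := (hhyp i).abs_translationLength_sub_le hδ (hgeo i) (ρ i g) (x i)
    have h2 : max 0 (D i 1 (g * g) - D i 1 g) = (N i)⁻¹ *
        max 0 (dist (x i) (ρ i g (ρ i g (x i))) - dist (x i) (ρ i g (x i))) := by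
      rw [mul_max_of_nonneg _ _ h0, mul_zero, mul_sub]
      simp only [hD, map_one, map_mul, IsometryEquiv.mul_apply, IsometryEquiv.coe_one, id]
    rw [h2, Pi.smul_apply, smul_eq_mul, ← mul_sub, Real.norm_eq_abs, abs_mul, abs_of_nonneg h0]
    exact mul_le_mul_of_nonneg_left h1 h0
  have := tendsto_nhds_unique hdiff (hLg.sub hmax)
  linarith

/-! ### A uniform bound for displacements -/

/-- The size of `(L, t)` as measured by finitely many coordinates of `L` and by `t`. -/
def lengthGauge {G : Type*} (F : Finset G) (δ : ℝ) (p : LF G × ℝ) : ℝ :=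
  ∑ g ∈ F, |p.1 g| + δ * |p.2|

theorem lengthGauge_smul {G : Type*} (F : Finset G) (δ c : ℝ) (p : LF G × ℝ) :
    lengthGauge F δ (c • p) = |c| * lengthGauge F δ p := by
  simp only [lengthGauge, Prod.smul_fst, Prod.smul_snd, Pi.smul_apply, smul_eq_mul, abs_mul,
    mul_add, Finset.mul_sum]
  ring

theorem continuous_lengthGauge {G : Type*} (F : Finset G) (δ : ℝ) :
    Continuous (lengthGauge F δ) := by
  unfold lengthGauge
  fun_prop

/-- An element of the subgroup generated by `S` moves a point at most a constant times as far as
the elements of `S` do. -/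
theorem exists_dist_le_of_mem_closure {G : Type*} [Group G] {S : Set G} {g : G}
    (hg : g ∈ Subgroup.closure S) :
    ∃ c : ℝ, ∀ (X : Type v) [MetricSpace X] (ρ : G →* (X ≃ᵢ X)) (x : X) (B : ℝ),
      (∀ s ∈ S, dist x (ρ s x) ≤ B) → dist x (ρ g x) ≤ c * B := by
  induction hg using Subgroup.closure_induction with
  | mem s hs => exact ⟨1, fun X _ ρ x B h => by simpa using h s hs⟩
  | one => exact ⟨0, fun X _ ρ x B _ => by simp⟩
  | mul a b _ _ ha hb =>
    obtain ⟨c, hc⟩ := ha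
    obtain ⟨c', hc'⟩ := hb
    refine ⟨c + c', fun X _ ρ x B h => ?_⟩
    have h1 := hc X ρ x B h
    have h2 := hc' X ρ x B h
    have h3 := dist_triangle x (ρ a x) (ρ a (ρ b x))
    rw [(ρ a).isometry.dist_eq] at h3
    rw [map_mul, IsometryEquiv.mul_apply]
    linarith
  | inv a _ ha =>
    obtain ⟨c, hc⟩ := ha
    refine ⟨c, fun X _ ρ x B h => ?_⟩
    rw [← (ρ a).isometry.dist_eq, ← IsometryEquiv.mul_apply, ← map_mul, mul_inv_cancel, map_one,
      IsometryEquiv.coe_one, id, dist_comm]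
    exact hc X ρ x B h

/-- Finitely many translation lengths control, for every hyperbolic action, the displacement of a
suitable point by every group element. -/
theorem exists_dist_le_lengthGauge (G : Type u) [Group G] [Group.FG G] {δ : ℝ} (hδ : 0 < δ) :
    ∃ (F : Finset G) (C : G → ℝ), ∀ (X : Type v) [MetricSpace X] [Nonempty X],
      IsGeodesicSpace X → FourPointHyperbolic δ X → ∀ ρ : G →* (X ≃ᵢ X), ∃ x : X, ∀ g,
        dist x (ρ g x) ≤ C g * lengthGauge F δ (lengthFunction ρ, 1) := by
  classical
  obtain ⟨S, hS⟩ := Group.fg_def.1 ‹Group.FG G›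
  choose c hc using fun g : G =>
    exists_dist_le_of_mem_closure.{v} (S := (S : Set G)) (g := g) (hS ▸ Subgroup.mem_top g)
  set F : Finset G := S ∪ (S ×ˢ S).image fun p => p.1 * p.2 with hF
  refine ⟨F, fun g => c g * 48, fun X _ _ hg hX ρ => ?_⟩
  set M := ∑ g ∈ F, |lengthFunction ρ g| with hM
  have hle : ∀ g ∈ F, translationLength (ρ g) ≤ M := fun g hg => (le_abs_self _).trans
    (Finset.single_le_sum (f := fun g => |lengthFunction ρ g|) (fun _ _ => abs_nonneg _) hg)
  have hM0 : 0 ≤ M := Finset.sum_nonneg fun _ _ => abs_nonneg _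
  obtain ⟨x, hx⟩ := hX.exists_dist_le_of_translationLength_le hδ hg S (fun g => ρ g) hM0
    (fun i hi => hle i (Finset.mem_union_left _ hi)) (fun i hi j hj => by
      have := hle (i * j) (Finset.mem_union_right _
        (Finset.mem_image.2 ⟨(i, j), Finset.mk_mem_product hi hj, rfl⟩))
      rwa [map_mul] at this)
  refine ⟨x, fun g => ?_⟩
  rw [mul_assoc]
  refine hc g X ρ x _ fun s hs => (hx s hs).trans ?_
  have : lengthGauge F δ (lengthFunction ρ, 1) = M + δ := by simp [lengthGauge, hM]
  rw [this]
  linarith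

/-! ### Topology of `LF(G) ∪ PLF(G)` -/

section Topology

variable {G : Type*}

theorem LFBar.surjective_ofHomogeneous :
    Function.Surjective (LFBar.ofHomogeneous : {p : LF G × ℝ // p ≠ 0} → LFBar G) := by
  rintro (L | p)
  · exact ⟨⟨(L, 1), fun h => one_ne_zero (congrArg Prod.snd h)⟩, by simp [LFBar.ofHomogeneous]⟩
  · induction p using Projectivization.ind with
    | h v hv => exact ⟨⟨(v, 0), fun h => hv (congrArg Prod.fst h)⟩, by simp [LFBar.ofHomogeneous]⟩

theorem LFBar.isOpenQuotientMap_ofHomogeneous :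
    IsOpenQuotientMap (LFBar.ofHomogeneous : {p : LF G × ℝ // p ≠ 0} → LFBar G) where
  surjective := LFBar.surjective_ofHomogeneous
  continuous := continuous_coinduced_rng
  isOpenMap U hU := by
    rw [isOpen_coinduced]
    have key : LFBar.ofHomogeneous ⁻¹' (LFBar.ofHomogeneous '' U) =
        ⋃ c : {c : ℝ // c ≠ 0}, (fun p : {p : LF G × ℝ // p ≠ 0} =>
          (⟨c.1 • p.1, smul_ne_zero c.2 p.2⟩ : {p : LF G × ℝ // p ≠ 0})) ⁻¹' U := by
      ext p
      simp only [Set.mem_preimage, Set.mem_image, Set.mem_iUnion]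
      constructor
      · rintro ⟨q, hq, hqp⟩
        obtain ⟨c, hc, h⟩ := (LFBar.ofHomogeneous_eq_iff p q).1 hqp.symm
        exact ⟨⟨c, hc⟩, by rwa [show (⟨c • p.1, _⟩ : {p : LF G × ℝ // p ≠ 0}) = q from
          Subtype.ext h.symm]⟩
      · rintro ⟨c, hc⟩
        exact ⟨_, hc, ((LFBar.ofHomogeneous_eq_iff p _).2 ⟨c.1, c.2, rfl⟩).symm⟩
    rw [key]
    refine isOpen_iUnion fun c => hU.preimage ?_
    exact (continuous_subtype_val.const_smul c.1).subtype_mk _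

/-- Proportionality of nonzero vectors is a closed condition, given by the vanishing of all
`2 × 2` minors. -/
instance LFBar.t2Space : T2Space (LFBar G) := by
  rw [t2Space_iff_of_isOpenQuotientMap LFBar.isOpenQuotientMap_ofHomogeneous]
  let φ : Option G → LF G × ℝ → ℝ := fun i p => i.elim p.2 p.1
  have hφ : ∀ i, Continuous (φ i) := by
    rintro (_ | g)
    · exact continuous_snd
    · exact (continuous_apply g).comp continuous_fst
  have hext : ∀ p q : LF G × ℝ, (∀ i, φ i p = φ i q) → p = q := fun p q h =>
    Prod.ext (funext fun g => h (some g)) (h none)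
  have hsmul : ∀ i (c : ℝ) p, φ i (c • p) = c * φ i p := by
    rintro (_ | g) c p <;> rfl
  have key : {q : {p : LF G × ℝ // p ≠ 0} × {p : LF G × ℝ // p ≠ 0} |
      LFBar.ofHomogeneous q.1 = LFBar.ofHomogeneous q.2} =
      ⋂ i, ⋂ j, {q | φ i q.1.1 * φ j q.2.1 = φ j q.1.1 * φ i q.2.1} := by
    ext ⟨p, q⟩
    simp only [Set.mem_ofPred_eq, Set.mem_iInter, LFBar.ofHomogeneous_eq_iff]
    constructor
    · rintro ⟨c, -, h⟩ i j
      rw [h, hsmul, hsmul]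
      ring
    · intro h
      obtain ⟨i, hi⟩ : ∃ i, φ i p.1 ≠ 0 := by
        by_contra! hcon
        exact p.2 (hext _ _ fun i => by
          rw [hcon i]
          cases i <;> rfl)
      have hq : q.1 = (φ i q.1 / φ i p.1) • p.1 := hext _ _ fun j => by
        rw [hsmul]
        have := h i j
        field_simp
        linarith
      refine ⟨_, fun h0 => q.2 ?_, hq⟩
      rw [hq, h0, zero_smul]
  rw [key]
  refine isClosed_iInter fun i => isClosed_iInter fun j => isClosed_eq ?_ ?_
  · exact ((hφ i).comp (continuous_subtype_val.comp continuous_fst)).mul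
      ((hφ j).comp (continuous_subtype_val.comp continuous_snd))
  · exact ((hφ j).comp (continuous_subtype_val.comp continuous_fst)).mul
      ((hφ i).comp (continuous_subtype_val.comp continuous_snd))

/-- The normalised pairs `(L, t)` all of whose coordinates are bounded in terms of the gauge. -/
def gaugeSlice (F : Finset G) (C : G → ℝ) (δ : ℝ) : Set (LF G × ℝ) :=
  {p | (∀ g, |p.1 g| ≤ C g) ∧ lengthGauge F δ p = 1}

theorem isCompact_gaugeSlice (F : Finset G) (C : G → ℝ) {δ : ℝ} (hδ : 0 < δ) :
    IsCompact (gaugeSlice F C δ) := by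
  have hc : IsCompact ((Set.univ.pi fun g => Set.Icc (-C g) (C g)) ×ˢ Set.Icc (-δ⁻¹) δ⁻¹) :=
    (isCompact_univ_pi fun g => isCompact_Icc).prod isCompact_Icc
  refine hc.of_isClosed_subset ?_ ?_
  · refine IsClosed.inter (s₁ := {p : LF G × ℝ | ∀ g, |p.1 g| ≤ C g}) ?_
      (isClosed_eq (continuous_lengthGauge F δ) continuous_const)
    simp only [Set.ofPred_forall]
    exact isClosed_iInter fun g => isClosed_le (by fun_prop) continuous_const
  · rintro p ⟨hp, hp1⟩
    refine ⟨fun g _ => abs_le.1 (hp g), abs_le.1 ?_⟩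
    have h1 : 0 ≤ ∑ g ∈ F, |p.1 g| := Finset.sum_nonneg fun _ _ => abs_nonneg _
    unfold lengthGauge at hp1
    rw [← one_div, le_div_iff₀ hδ]
    linarith

theorem ne_zero_of_mem_gaugeSlice {F : Finset G} {C : G → ℝ} {δ : ℝ} {p : LF G × ℝ}
    (hp : p ∈ gaugeSlice F C δ) : p ≠ 0 := by
  rintro rfl
  simpa [lengthGauge] using hp.2

theorem isCompact_ofHomogeneous_image_gaugeSlice (F : Finset G) (C : G → ℝ) {δ : ℝ} (hδ : 0 < δ) :
    IsCompact (LFBar.ofHomogeneous '' (Subtype.val ⁻¹' gaugeSlice F C δ)) := by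
  refine IsCompact.image ?_ LFBar.isOpenQuotientMap_ofHomogeneous.continuous
  refine IsInducing.subtypeVal.isCompact_preimage' (isCompact_gaugeSlice F C hδ) fun p hp => ?_
  exact ⟨⟨p, ne_zero_of_mem_gaugeSlice hp⟩, rfl⟩

end Topology

/-! ### Compactness and ideal points -/

theorem mainTheorem4 (G : Type u) [Group G] [Group.FG G] (Δ : ℝ) (hΔ : 0 < Δ) :
    IsCompact (closure (LFBar.finite '' Set.range (HomThin.L : HomThin.{u, v} Δ G → LF G))) ∧
    ∀ p : PLF G,
      LFBar.ideal p ∈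
          closure (LFBar.finite '' Set.range (HomThin.L : HomThin.{u, v} Δ G → LF G)) →
        ∃ (T : Type u) (_ : MetricSpace T) (_ : IsRTree T) (σ : G →* (T ≃ᵢ T))
          (hσ : lengthFunction σ ≠ 0),
          p = Projectivization.mk ℝ (lengthFunction σ) hσ ∧ ¬ ∃ x : T, ∀ g : G, σ g x = x := by
  have hδ : 0 < 3 * Δ := by linarith
  obtain ⟨F, C, hC⟩ := exists_dist_le_lengthGauge.{u, v} G hδ
  have hhyp : ∀ r : HomThin.{u, v} Δ G, FourPointHyperbolic (3 * Δ) r.X := fun r =>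
    r.thin.fourPointHyperbolic r.geodesic
  choose x hx using fun r : HomThin.{u, v} Δ G => hC r.X r.geodesic (hhyp r) r.ρ
  set N : HomThin.{u, v} Δ G → ℝ := fun r => lengthGauge F (3 * Δ) (r.L, 1) with hN
  have hN0 : ∀ r, 0 < N r := fun r => by
    have : 0 ≤ ∑ g ∈ F, |r.L g| := Finset.sum_nonneg fun _ _ => abs_nonneg _
    simp only [hN, lengthGauge, abs_one]
    linarith
  -- The normalised representative of the length function of `r`.
  set Q : HomThin.{u, v} Δ G → LF G × ℝ := fun r => (N r)⁻¹ • (r.L, 1) with hQ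
  have hQK : ∀ r, Q r ∈ gaugeSlice F C (3 * Δ) := by
    intro r
    refine ⟨fun g => ?_, ?_⟩
    · show |(N r)⁻¹ * r.L g| ≤ C g
      rw [abs_mul, abs_inv, abs_of_pos (hN0 r), inv_mul_le_iff₀ (hN0 r), mul_comm]
      refine (abs_of_nonneg (translationLength_nonneg (r.ρ g))).le.trans ?_
      exact (translationLength_le (r.ρ g) (x r)).trans (hx r g)
    · simp only [hQ]
      rw [lengthGauge_smul, abs_inv, abs_of_pos (hN0 r)]
      exact inv_mul_cancel₀ (hN0 r).ne'
  have hQ0 : ∀ r, Q r ≠ 0 := fun r => ne_zero_of_mem_gaugeSlice (hQK r)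
  have hQL : ∀ r, LFBar.ofHomogeneous ⟨Q r, hQ0 r⟩ = LFBar.finite r.L := by
    intro r
    simp [LFBar.ofHomogeneous, hQ, (hN0 r).ne', smul_smul]
  have hcpt := isCompact_ofHomogeneous_image_gaugeSlice F C hδ
  refine ⟨hcpt.of_isClosed_subset isClosed_closure (closure_minimal ?_ hcpt.isClosed), ?_⟩
  · rintro _ ⟨_, ⟨r, rfl⟩, rfl⟩
    exact ⟨⟨Q r, hQ0 r⟩, hQK r, hQL r⟩
  intro p hp
  rw [← Set.range_comp] at hp
  have hne : (comap (LFBar.finite ∘ HomThin.L : HomThin.{u, v} Δ G → LFBar G)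
      (𝓝 (LFBar.ideal p))).NeBot := by
    rw [comap_neBot_iff]
    intro t ht
    obtain ⟨_, hy, r, rfl⟩ := mem_closure_iff_nhds.1 hp t ht
    exact ⟨r, hy⟩
  set 𝓤 := Ultrafilter.of (comap (LFBar.finite ∘ HomThin.L : HomThin.{u, v} Δ G → LFBar G)
      (𝓝 (LFBar.ideal p))) with h𝓤
  have hUp : Tendsto (fun r : HomThin.{u, v} Δ G => LFBar.finite r.L) 𝓤 (𝓝 (LFBar.ideal p)) :=
    tendsto_comap.mono_left (Ultrafilter.of_le _)
  obtain ⟨⟨L, t⟩, hLK, hlim⟩ := (isCompact_gaugeSlice F C hδ).ultrafilter_le_nhds (𝓤.map Q)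
    (tendsto_principal.2 (Eventually.of_forall hQK))
  replace hlim : Tendsto Q 𝓤 (𝓝 (L, t)) := hlim
  have hLt := ne_zero_of_mem_gaugeSlice hLK
  have hlim' : Tendsto (fun r => (⟨Q r, hQ0 r⟩ : {p : LF G × ℝ // p ≠ 0})) 𝓤
      (𝓝 ⟨(L, t), hLt⟩) := tendsto_subtype_rng.2 hlim
  have hlim2 := (LFBar.isOpenQuotientMap_ofHomogeneous.continuous.tendsto _).comp hlim'
  have heq : LFBar.ideal p = LFBar.ofHomogeneous ⟨(L, t), hLt⟩ :=
    tendsto_nhds_unique hUp (hlim2.congr hQL)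
  have ht : t = 0 := by
    by_contra ht
    simp [LFBar.ofHomogeneous, ht] at heq
  subst ht
  have hL0 : L ≠ 0 := fun h => hLt (Prod.ext h rfl)
  simp only [LFBar.ofHomogeneous, dif_pos, LFBar.ideal.injEq] at heq
  obtain ⟨T, hT, hT', σ, hσ⟩ := exists_rTree_of_tendsto_lengthFunction 𝓤 hδ.le
    (fun r : HomThin.{u, v} Δ G => r.X) (fun r => r.geodesic) hhyp (fun r => r.ρ) x N hN0
    (by simpa [hQ] using hlim.snd_nhds) C hx L hlim.fst_nhds
  refine ⟨T, hT, hT', σ, hσ ▸ hL0, ?_, ?_⟩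
  · rw [heq]
    congr 1
    exact hσ.symm
  · rintro ⟨y, hy⟩
    refine hL0 (funext fun g => ?_)
    rw [← hσ]
    refine le_antisymm ?_ (translationLength_nonneg (σ g))
    have := translationLength_le (σ g) y
    rwa [hy g, dist_self] at this
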